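/- Let $\mathbb{K}$ be an algebraically closed field of characteristic zero. For a finite simple graph $G$ with vertex set $V(G)$ and edge set $E(G)$, let $\mathbb{K}[E(G)]$ be the polynomial ring whose variables are the edges of $G$, let $\mathbb{K}[V(G)]$ be the polynomial ring whose variables $x_v$ are indexed by the vertices, and let the toric ideal $I_G\subseteq\mathbb{K}[E(G)]$ be the kernel of the $\mathbb{K}$-algebra homomorphism $\mathbb{K}[E(G)]\to\mathbb{K}[V(G)]$ sending each edge $\{a,b\}$ to $x_ax_b$. Let $R=\mathbb{K}[x_1,\dots,x_n]$ and let $y$ be one of its variables. If $0\ne f\in R$ has degree $d$ in $y$, write $f=y^dq+r$, where $y$ divides no term of $q$ and $r$ has degree less than $d$ in $y$; put $\mathrm{in}_y(f)=y^dq$, and $\mathrm{in}_y(0)=0$. Let $\mathrm{in}_y(I)=\langle \mathrm{in}_y(f)\mid f\in I\rangle$. A monomial order $<$ is $y$-compatible if $\mathrm{in}_<(f)=\mathrm{in}_<(\mathrm{in}_y(f))$ for all $f\in R$. Given an ideal $I$ and a Gröbner basis $\{g_1,\dots,g_m\}$ of $I$ for such an order, with $\mathrm{in}_y(g_i)=y^{d_i}q_i$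 as above, put $C_{y,I}=\langle q_1,\dots,q_m\rangle$ and $N_{y,I}=\langle q_i\mid d_i=0\rangle$. An ideal $I$ is unmixed if $\dim(R/I)=\dim(R/P)$ for all associated primes $P$ of $R/I$. Recursively on the number of variables, $I$ is geometrically vertex decomposable if it is unmixed and either 1. $I=\langle 1\rangle$, or $I$ is generated by a (possibly empty) set of variables of $R$; or 2. there are a variable $y$ of $R$ and a $y$-compatible monomial order such that $\mathrm{in}_y(I)=C_{y,I}\cap(N_{y,I}+\langle y\rangle)$ and the contractions of $C_{y,I}$ and $N_{y,I}$ to the polynomial ring in the variables of $R$ other than $y$ are geometrically vertex decomposable. **Theorem.** Let $G$ be a finite simple graph such that $I_G$ is geometrically vertex decomposable in $\mathbb{K}[E(G)]$. Let $H$ be obtained from $G$ by gluing a cycle $C$ of even length $2n\ge 4$ onto an edge of $G$; that is, $H$ is the disjoint union of $G$ and $C$ with an edge of $C$ identified, together with its two endpoints (in either of the two ways), with an edge of $G$. Then $I_H$ is geometrically vertex decomposable in $\mathbb{K}[E(H)]$. -/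

import Mathlib

universe u v

noncomputable section

namespace GVD

open MvPolynomial

/-! ### Geometrically vertex decomposable ideals -/

section Ideals

variable {K : Type v} [Field K] {σ : Type u}

/-- The initial `y`-form of `f`: writing `f = ∑ αᵢ yⁱ` with the `αᵢ` free of `y`, this is
`α_d y^d`, where `d` is the degree of `f` in `y` (and it is `0` for `f = 0`). -/
def initYForm (y : σ) (f : MvPolynomial σ K) : MvPolynomial σ K :=
  ∑ d ∈ f.support with d y = f.degreeOf y, monomial d (f.coeff d)

/-- The coefficient of the initial `y`-form: the polynomial `q`, free of `y`, such that the
initial `y`-form of `f` is `y ^ d * q`, where `d` is the degree of `f` in `y`. -/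
def initYCoeff (y : σ) (f : MvPolynomial σ K) : MvPolynomial σ K :=
  ∑ d ∈ f.support with d y = f.degreeOf y, monomial (d.erase y) (f.coeff d)

theorem initYForm_eq (y : σ) (f : MvPolynomial σ K) :
    initYForm y f = X y ^ f.degreeOf y * initYCoeff y f := by
  classical
  rw [initYForm, initYCoeff, Finset.mul_sum]
  refine Finset.sum_congr rfl fun d hd => ?_
  rw [X_pow_eq_monomial, monomial_mul, one_mul, ← (Finset.mem_filter.mp hd).2,
    Finsupp.single_add_erase]

/-- `in_y(I)`, the ideal generated by the initial `y`-forms of the elements of `I`. -/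
def initYIdeal (y : σ) (I : Ideal (MvPolynomial σ K)) : Ideal (MvPolynomial σ K) :=
  Ideal.span (initYForm y '' (I : Set (MvPolynomial σ K)))

/-- A monomial order is `y`-compatible if every polynomial has the same initial term as
its initial `y`-form. -/
def YCompatible (K : Type v) [Field K] (m : MonomialOrder.{u, u} σ) (y : σ) : Prop :=
  ∀ f : MvPolynomial σ K, m.leadingTerm f = m.leadingTerm (initYForm y f)

/-- `G` is a Gröbner basis of `I` with respect to the monomial order `m`. -/
def IsGroebnerBasis (m : MonomialOrder.{u, u} σ) (I : Ideal (MvPolynomial σ K))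
    (G : Set (MvPolynomial σ K)) : Prop :=
  G.Finite ∧ G ⊆ I ∧
    Ideal.span (m.leadingTerm '' G) = Ideal.span (m.leadingTerm '' (I : Set (MvPolynomial σ K)))

/-- `C_{y,I}`, computed from a Gröbner basis `G` of `I`: generated by the `q`'s. -/
def idealC (y : σ) (G : Set (MvPolynomial σ K)) : Ideal (MvPolynomial σ K) :=
  Ideal.span (initYCoeff y '' G)

/-- `N_{y,I}`, computed from a Gröbner basis `G` of `I`: generated by those `q`'s that come from
elements of `G` not involving `y`. -/
def idealN (y : σ) (G : Set (MvPolynomial σ K)) : Ideal (MvPolynomial σ K) :=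
  Ideal.span (initYCoeff y '' {g ∈ G | g.degreeOf y = 0})

/-- The contraction of an ideal to the polynomial ring in all the variables but `y`. -/
def contraction (y : σ) (I : Ideal (MvPolynomial σ K)) : Ideal (MvPolynomial {x : σ // x ≠ y} K) :=
  I.comap (rename (Subtype.val : {x : σ // x ≠ y} → σ))

/-- An ideal `I` of `R` is unmixed if `dim (R/I) = dim (R/P)` for all associated primes `P`
of `R/I`. -/
def IsUnmixed {R : Type*} [CommRing R] (I : Ideal R) : Prop :=
  ∀ P ∈ associatedPrimes R (R ⧸ I), ringKrullDim (R ⧸ I) = ringKrullDim (R ⧸ P)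

/-- Geometrically vertex decomposable ideals. -/
inductive IsGVD {K : Type v} [Field K] : ∀ {σ : Type u}, Ideal (MvPolynomial σ K) → Prop
  | top {σ : Type u} {I : Ideal (MvPolynomial σ K)} (unmixed : IsUnmixed I) (h : I = ⊤) :
      IsGVD I
  | vars {σ : Type u} {I : Ideal (MvPolynomial σ K)} (unmixed : IsUnmixed I) (s : Set σ)
      (h : I = Ideal.span (X '' s)) : IsGVD I
  | decomp {σ : Type u} {I : Ideal (MvPolynomial σ K)} (unmixed : IsUnmixed I) (y : σ)
      (m : MonomialOrder.{u, u} σ) (compatible : YCompatible K m y)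
      (G : Set (MvPolynomial σ K)) (groebner : IsGroebnerBasis m I G)
      (decomposition : initYIdeal y I = idealC y G ⊓ (idealN y G ⊔ Ideal.span {X y}))
      (gvdC : IsGVD (contraction y (idealC y G)))
      (gvdN : IsGVD (contraction y (idealN y G))) : IsGVD I

end Ideals

/-! ### Toric ideals of graphs -/

section Graphs

variable {V : Type u}

/-- The monomial `x_a x_b` of an edge `{a, b}`. -/
def edgeMonomial (K : Type v) [Field K] (e : Sym2 V) : MvPolynomial V K :=
  Sym2.lift ⟨fun a b => X a * X b, fun a b => mul_comm (X a) (X b)⟩ e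

/-- The toric ideal `I_G ⊆ K[E(G)]`, the kernel of `K[E(G)] → K[V(G)]`, `{a, b} ↦ x_a x_b`. -/
def toricIdeal (K : Type v) [Field K] (G : SimpleGraph V) : Ideal (MvPolynomial G.edgeSet K) :=
  RingHom.ker (aeval fun e : G.edgeSet => edgeMonomial K (e : Sym2 V) :
    MvPolynomial G.edgeSet K →ₐ[K] MvPolynomial V K)

variable {V₁ : Type u} {V₂ : Type v} {G₁ : SimpleGraph V₁} {G₂ : SimpleGraph V₂}
  {W₁ : Set V₁} {W₂ : Set V₂}

/-- The vertices of the graph obtained by gluing along `W₁ ≅ W₂`: all of `V₁`, and those elements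
of `V₂` that are not identified with an element of `V₁`. -/
abbrev GlueVertex (V₁ : Type u) {V₂ : Type v} (W₂ : Set V₂) : Type (max u v) :=
  V₁ ⊕ {w : V₂ // w ∉ W₂}

/-- The map from the vertices of the second graph to the vertices of the glued graph. -/
def glueRight (φ : G₁.induce W₁ ≃g G₂.induce W₂) (w : V₂) : GlueVertex V₁ W₂ :=
  open Classical in
  if h : w ∈ W₂ then Sum.inl (φ.symm ⟨w, h⟩ : W₁) else Sum.inr ⟨w, h⟩

/-- The gluing `G₁ ∪_φ G₂` of two graphs along an isomorphism `φ` of induced subgraphs: the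
disjoint union of `G₁` and `G₂`, with `v` and `φ v` identified for all `v` in `W₁`. -/
def glue (φ : G₁.induce W₁ ≃g G₂.induce W₂) : SimpleGraph (GlueVertex V₁ W₂) :=
  G₁.map Sum.inl ⊔ G₂.map (glueRight φ)

theorem glueRight_injective (φ : G₁.induce W₁ ≃g G₂.induce W₂) :
    Function.Injective (glueRight φ) := by
  intro w w' h
  unfold glueRight at h
  split_ifs at h with h₁ h₂ h₂
  · have := φ.symm.injective (Subtype.ext (Sum.inl.inj h))
    exact congrArg Subtype.val this
  · exact congrArg Subtype.val (Sum.inr.inj h)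

/-- The vertices `v` of `G₁` and `w` of `G₂` are identified precisely if `φ v = w`. -/
theorem inl_eq_glueRight_iff (φ : G₁.induce W₁ ≃g G₂.induce W₂) (v : V₁) (w : V₂) :
    (Sum.inl v : GlueVertex V₁ W₂) = glueRight φ w ↔ ∃ h : v ∈ W₁, (φ ⟨v, h⟩ : V₂) = w := by
  unfold glueRight
  split_ifs with hw
  · constructor
    · intro h
      have hv : v = (φ.symm ⟨w, hw⟩ : W₁) := Sum.inl.inj h
      subst hv
      exact ⟨Subtype.coe_prop _, by simp⟩
    · rintro ⟨h, rfl⟩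
      simp
  · constructor
    · intro h
      cases h
    · rintro ⟨h, rfl⟩
      exact absurd (Subtype.coe_prop _) hw

end Graphs

end GVD

end

noncomputable section

namespace GVD

open MvPolynomial

/-! The new edges form a path `u 0, …, u (2 * N + 1)` of odd length from `a` to `b`, where `N = n -
1`. Let `y` be its first edge and regard `I_H` as an ideal of polynomials in `y` over the ring in
the other edges.

The elements free of `y` form the extension `Q` of `I_G`: once `y` is removed, the rest of the path
hangs off `b` as a tail and contributes no relation (`ker_eq_map_rename`). The even cycle
contributes the binomial `w y - q`, where `w y` and `q` are the products over its two alternating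
classes of edges. The leading coefficients in `y` are exactly `Q + (w)`: if `p` in `I_H` has degree
`d`, multiplying by `w ^ d` and replacing `w y` by `q` gives `∑ p_i q ^ i w ^ (d - i)` in `Q`, so
`p_d q ^ d` lies in `Q + (w)` (`leadingCoeff_mem_of_mem_ker`). Moreover `Q + (w)` is the
intersection of the primes `Q + (z)` over the variables `z` dividing `w` (`sup_span_prod_eq_inf`),
and none of these contains a variable of `q`, so `q` can be cancelled.

Gröbner bases are disposed of once and for all: for every compatible order, `C_{y,I}` and `N_{y,I}`
come from the ideals of all leading coefficients and of the elements of degree zero, and the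
decomposition says that elements of degree at most one already supply all leading coefficients
(`initYIdeal_eq_iff`). Here these ideals are `Q + (w)` and `Q`. The second is decomposable because
adding variables is harmless (`IsGVD.map_rename`), the first by splitting off the factors of `w` one
at a time (`IsGVD.sup_span_prod`).

Unmixedness holds for toric ideals since they are prime, for `Q + (w)` since it is an intersection
of primes of equal dimension, and for extensions to more variables since their associated primes are
extended. -/

theorem map_map_of_eq {R S T F G H : Type*} [CommRing R] [CommRing S] [CommRing T]
    [FunLike F R S] [RingHomClass F R S] [FunLike G S T] [RingHomClass G S T]
    [FunLike H R T] [RingHomClass H R T] (I : Ideal R) (f : F) (g : G) (h : H)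
    (hgf : ∀ x, g (f x) = h x) : (I.map f).map g = I.map h := by
  change (Ideal.span (f '' I)).map g = Ideal.span (h '' I)
  rw [Ideal.map_span, Set.image_image]
  simp_rw [hgf]

/-! ### Polynomials in one distinguished variable -/

section Bridge
variable {K : Type v} [Field K] {σ : Type u}

/-- `K[σ]` as the ring of polynomials in `y` over the polynomial ring in the other variables. -/
def polyEquiv (K : Type v) [Field K] (y : σ) :
    MvPolynomial σ K ≃ₐ[K] Polynomial (MvPolynomial {x : σ // x ≠ y} K) :=
  open Classical in
  (renameEquiv K (Equiv.optionSubtypeNe y).symm).trans (optionEquivLeft K _)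

@[simp]
theorem polyEquiv_X_self (y : σ) : polyEquiv K y (X y) = Polynomial.X := by
  classical
  simp [polyEquiv, Equiv.optionSubtypeNe_symm_apply, optionEquivLeft_X_none]

@[simp]
theorem polyEquiv_X_of_ne (y : σ) (x : {x : σ // x ≠ y}) :
    polyEquiv K y (X x.1) = Polynomial.C (X x) := by
  classical
  simp [polyEquiv, Equiv.optionSubtypeNe_symm_apply, x.2, optionEquivLeft_X_some]

@[simp]
theorem polyEquiv_rename (y : σ) (p : MvPolynomial {x : σ // x ≠ y} K) :
    polyEquiv K y (rename Subtype.val p) = Polynomial.C p := by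
  induction p using MvPolynomial.induction_on with
  | C a => simp [polyEquiv]
  | add p q hp hq => simp [hp, hq]
  | mul_X p x hp => rw [map_mul, map_mul, hp, rename_X, polyEquiv_X_of_ne, map_mul]

@[simp]
theorem polyEquiv_symm_C (y : σ) (p : MvPolynomial {x : σ // x ≠ y} K) :
    (polyEquiv K y).symm (Polynomial.C p) = rename Subtype.val p := by
  rw [AlgEquiv.symm_apply_eq, polyEquiv_rename]

theorem natDegree_polyEquiv (y : σ) (f : MvPolynomial σ K) :
    (polyEquiv K y f).natDegree = f.degreeOf y := by
  classical
  exact (degreeOf_eq_natDegree y f).symm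

theorem rename_monomial_subtypeDomain (y : σ) (d : σ →₀ ℕ) (c : K) :
    rename Subtype.val (monomial (d.subtypeDomain (· ≠ y)) c) = monomial (d.erase y) c := by
  classical
  rw [rename_monomial]
  refine congrArg (fun e => monomial e c) (Finsupp.ext fun x => ?_)
  by_cases h : x = y
  · subst h
    rw [Finsupp.mapDomain_of_notMem_range _ _ (by simp)]
    simp
  · rw [show x = ((⟨x, h⟩ : {x : σ // x ≠ y}) : σ) from rfl,
      Finsupp.mapDomain_apply Subtype.val_injective]
    simp [h]

theorem polyEquiv_monomial (y : σ) (d : σ →₀ ℕ) (c : K) :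
    polyEquiv K y (monomial d c) =
      Polynomial.monomial (d y) (monomial (d.subtypeDomain (· ≠ y)) c) := by
  have h : monomial d c = X y ^ d y * rename Subtype.val (monomial (d.subtypeDomain (· ≠ y)) c) := by
    rw [rename_monomial_subtypeDomain, X_pow_eq_monomial, monomial_mul, one_mul,
      Finsupp.single_add_erase]
  rw [h, map_mul, map_pow, polyEquiv_X_self, polyEquiv_rename, mul_comm,
    Polynomial.C_mul_X_pow_eq_monomial]

/-- This turns the combinatorial definition of `q` into an ordinary leading coefficient, so that
ideals of leading coefficients can replace Gröbner bases. -/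
theorem initYCoeff_eq (y : σ) (f : MvPolynomial σ K) :
    initYCoeff y f = rename Subtype.val (polyEquiv K y f).leadingCoeff := by
  have h : (polyEquiv K y f).leadingCoeff =
      ∑ d ∈ f.support with d y = f.degreeOf y, monomial (d.subtypeDomain (· ≠ y)) (f.coeff d) := by
    rw [Polynomial.leadingCoeff, natDegree_polyEquiv]
    conv_lhs => enter [1]; rw [f.as_sum, map_sum]
    rw [Polynomial.finsetSum_coeff]
    rw [Finset.sum_filter]
    refine Finset.sum_congr rfl fun d _ => ?_
    rw [polyEquiv_monomial, Polynomial.coeff_monomial]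
  rw [h, map_sum, initYCoeff]
  exact Finset.sum_congr rfl fun d _ => (rename_monomial_subtypeDomain y d _).symm

theorem polyEquiv_initYCoeff (y : σ) (f : MvPolynomial σ K) :
    polyEquiv K y (initYCoeff y f) = Polynomial.C (polyEquiv K y f).leadingCoeff := by
  rw [initYCoeff_eq, polyEquiv_rename]

theorem polyEquiv_initYForm (y : σ) (f : MvPolynomial σ K) :
    polyEquiv K y (initYForm y f) =
      Polynomial.monomial (polyEquiv K y f).natDegree (polyEquiv K y f).leadingCoeff := by
  rw [initYForm_eq, map_mul, map_pow, polyEquiv_X_self, polyEquiv_initYCoeff, natDegree_polyEquiv,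
    mul_comm, Polynomial.C_mul_X_pow_eq_monomial]

theorem contraction_map_rename (y : σ) (J : Ideal (MvPolynomial {x : σ // x ≠ y} K)) :
    contraction y (J.map (rename (Subtype.val : {x : σ // x ≠ y} → σ))) = J := by
  refine le_antisymm (fun p hp => ?_) Ideal.le_comap_map
  have h := Ideal.mem_map_of_mem (polyEquiv K y) (Ideal.mem_comap.mp hp)
  rw [map_map_of_eq J _ _ Polynomial.C (polyEquiv_rename y)] at h
  have := Ideal.mem_map_C_iff.mp h 0
  simpa using this

end Bridge

/-! ### From Gröbner bases to ideals of leading coefficients -/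

section Groebner
variable {K : Type v} [Field K] {σ : Type u}

open scoped MonomialOrder

theorem YCompatible.le_of_le {m : MonomialOrder.{u, u} σ} {y : σ} (h : YCompatible K m y)
    {d d' : σ →₀ ℕ} (hd : d ≼[m] d') : d y ≤ d' y := by
  classical
  by_contra! hlt
  have hne : d ≠ d' := by rintro rfl; exact lt_irrefl _ hlt
  -- Compatibility is tested on a polynomial with just these two terms: if `d` had the larger
  -- `y`-exponent, the initial `y`-form would be the term of `d` alone, making `d` the leading
  -- exponent.
  set f : MvPolynomial σ K := monomial d 1 + monomial d' 1 with hf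
  have hsupp : f.support = {d, d'} := by
    ext e
    simp only [hf, mem_support_iff, coeff_add, coeff_monomial, Finset.mem_insert,
      Finset.mem_singleton, eq_comm (a := e)]
    by_cases h1 : d = e <;> by_cases h2 : d' = e <;> simp_all
  have hdeg : f.degreeOf y = d y := by
    rw [degreeOf_eq_sup, hsupp]
    simp [hlt.le]
  have hform : initYForm y f = monomial d 1 := by
    rw [initYForm, hsupp, hdeg, Finset.filter_insert, Finset.filter_singleton]
    simp [hlt.ne, hf, coeff_monomial, hne.symm]
  have h1 : m.degree f = d := by
    have := congrArg m.degree (h f)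
    rwa [hform, MonomialOrder.degree_leadingTerm, MonomialOrder.degree_leadingTerm,
      MonomialOrder.degree_monomial, if_neg one_ne_zero] at this
  have h2 : d' ≼[m] m.degree f := m.le_degree (by simp [hsupp])
  rw [h1] at h2
  exact hne (m.toSyn.injective (le_antisymm hd h2))

theorem YCompatible.degreeOf_le {m : MonomialOrder.{u, u} σ} {y : σ} (h : YCompatible K m y)
    {p f : MvPolynomial σ K} (hp : m.degree p ≼[m] m.degree f) :
    p.degreeOf y ≤ f.degreeOf y := by
  have hf : m.degree f y ≤ f.degreeOf y := by
    by_cases h0 : f = 0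
    · simp [h0]
    · exact monomial_le_degreeOf y (m.degree_mem_support h0)
  rw [degreeOf_le_iff]
  exact fun a ha => (h.le_of_le ((m.le_degree ha).trans hp)).trans hf

/-- Elements of an ideal have standard representations in terms of a Gröbner basis. -/
theorem exists_groebner_repr {m : MonomialOrder.{u, u} σ} {I : Ideal (MvPolynomial σ K)}
    {G : Set (MvPolynomial σ K)} (hG : IsGroebnerBasis m I G) {f : MvPolynomial σ K} (hf : f ∈ I) :
    ∃ g : (G \ {0} : Set (MvPolynomial σ K)) →₀ MvPolynomial σ K,
      f = g.sum (fun b h => h * (b : MvPolynomial σ K)) ∧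
      ∀ b : (G \ {0} : Set (MvPolynomial σ K)),
        m.degree ((b : MvPolynomial σ K) * g b) ≼[m] m.degree f := by
  -- Zero is discarded because division needs invertible leading coefficients. The remainder lies in
  -- `I` but no leading monomial of the basis divides any of its terms, so it vanishes.
  obtain ⟨g, r, hfr, hdeg, hr⟩ := m.div_set (B := G \ {0})
    (fun b hb => (m.leadingCoeff_ne_zero_iff.mpr hb.2).isUnit) f
  refine ⟨g, ?_, hdeg⟩
  rw [Finsupp.linearCombination_apply] at hfr
  suffices h0 : r = 0 by simpa [h0] using hfr
  by_contra h0
  have hrI : r ∈ I := by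
    have : r = f - g.sum (fun b h => h • (b : MvPolynomial σ K)) := by rw [hfr]; ring
    rw [this]
    refine I.sub_mem hf (I.sum_mem fun b _ => ?_)
    exact I.smul_mem _ (hG.2.1 b.2.1)
  have h1 : m.leadingTerm r ∈ Ideal.span (m.leadingTerm '' G) := by
    rw [hG.2.2]
    exact Ideal.subset_span ⟨r, hrI, rfl⟩
  have h2 : Ideal.span (m.leadingTerm '' G) ≤
      Ideal.span ((fun s => monomial s (1 : K)) '' (m.degree '' (G \ {0}))) := by
    rw [Ideal.span_le]
    rintro _ ⟨b, hb, rfl⟩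
    by_cases hb0 : b = 0
    · simp [hb0]
    · rw [← m.C_mul_leadingCoeff_monomial_degree]
      exact Ideal.mul_mem_left _ _ (Ideal.subset_span ⟨_, ⟨b, ⟨hb, hb0⟩, rfl⟩, rfl⟩)
  obtain ⟨_, ⟨b, hb, rfl⟩, hle⟩ := mem_ideal_span_monomial_image.mp (h2 h1) (m.degree r) (by
    classical
    rw [m.support_leadingTerm' h0]; simp)
  exact hr _ (m.degree_mem_support h0) b hb hle

theorem mem_map_polyEquiv {y : σ} {I : Ideal (MvPolynomial σ K)}
    {p : Polynomial (MvPolynomial {x : σ // x ≠ y} K)} :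
    p ∈ I.map (polyEquiv K y) ↔ ∃ f ∈ I, polyEquiv K y f = p :=
  Ideal.mem_map_of_equiv (polyEquiv K y) p

theorem mem_leadingCoeffNth_iff {R : Type*} [CommRing R] {J : Ideal (Polynomial R)} {n : ℕ}
    {x : R} : x ∈ J.leadingCoeffNth n ↔ ∃ p ∈ J, p.natDegree ≤ n ∧ p.coeff n = x := by
  simp only [Ideal.leadingCoeffNth, Ideal.degreeLE, Submodule.mem_map, Polynomial.lcoeff_apply,
    Submodule.mem_inf, Polynomial.mem_degreeLE, Polynomial.natDegree_le_iff_degree_le]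
  constructor
  · rintro ⟨p, ⟨h1, h2⟩, h⟩
    exact ⟨p, h2, h1, h⟩
  · rintro ⟨p, h2, h1, h⟩
    exact ⟨p, ⟨h1, h2⟩, h⟩

/-- No summand of a standard representation of `f` exceeds `f` in `y`-degree. Hence the coefficient
of `y ^ n` in `f` is a sum of leading coefficients of those summands that have degree exactly `n`,
and these are multiples of leading coefficients of basis elements. -/
theorem leadingCoeffNth_eq_span {m : MonomialOrder.{u, u} σ} {y : σ} (hm : YCompatible K m y)
    {I : Ideal (MvPolynomial σ K)} {G : Set (MvPolynomial σ K)} (hG : IsGroebnerBasis m I G)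
    (n : ℕ) :
    (I.map (polyEquiv K y)).leadingCoeffNth n =
      Ideal.span ((fun g => (polyEquiv K y g).leadingCoeff) '' {g ∈ G | g.degreeOf y ≤ n}) := by
  refine le_antisymm (fun x hx => ?_) ?_
  · obtain ⟨p, hp, hpn, rfl⟩ := mem_leadingCoeffNth_iff.mp hx
    obtain ⟨f, hf, rfl⟩ := mem_map_polyEquiv.mp hp
    obtain ⟨g, hfg, hdeg⟩ := exists_groebner_repr hG hf
    rw [hfg, Finsupp.sum, map_sum, Polynomial.finsetSum_coeff]
    refine Ideal.sum_mem _ fun b _ => ?_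
    have hb : (polyEquiv K y (g b * b)).natDegree ≤ n := by
      rw [natDegree_polyEquiv] at hpn ⊢
      rw [mul_comm]
      exact (hm.degreeOf_le (hdeg b)).trans hpn
    by_cases hlt : (polyEquiv K y (g b * b)).natDegree < n
    · rw [Polynomial.coeff_eq_zero_of_natDegree_lt hlt]
      exact zero_mem _
    obtain rfl := le_antisymm hb (not_lt.mp hlt)
    rw [Polynomial.coeff_natDegree, map_mul, Polynomial.leadingCoeff_mul]
    by_cases h0 : g b = 0
    · simp [h0]
    refine Ideal.mul_mem_left _ _ (Ideal.subset_span ⟨b, ⟨b.2.1, ?_⟩, rfl⟩)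
    rw [← natDegree_polyEquiv, Polynomial.natDegree_mul]
    · exact Nat.le_add_left _ _
    · simpa using h0
    · simpa using b.2.2
  · rw [Ideal.span_le]
    rintro _ ⟨g, ⟨hg, hn⟩, rfl⟩
    refine (Ideal.mem_leadingCoeffNth _ _ _).mpr
      ⟨_, mem_map_polyEquiv.mpr ⟨g, hG.2.1 hg, rfl⟩, ?_, rfl⟩
    rwa [← Polynomial.natDegree_le_iff_degree_le, natDegree_polyEquiv]

theorem idealN_eq {m : MonomialOrder.{u, u} σ} {y : σ} (hm : YCompatible K m y)
    {I : Ideal (MvPolynomial σ K)} {G : Set (MvPolynomial σ K)} (hG : IsGroebnerBasis m I G) :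
    idealN y G = ((I.map (polyEquiv K y)).leadingCoeffNth 0).map
      (rename (Subtype.val : {x : σ // x ≠ y} → σ)) := by
  rw [leadingCoeffNth_eq_span hm hG, Ideal.map_span, Set.image_image, idealN]
  simp_rw [← initYCoeff_eq, Nat.le_zero]

theorem idealC_eq {m : MonomialOrder.{u, u} σ} {y : σ} (hm : YCompatible K m y)
    {I : Ideal (MvPolynomial σ K)} {G : Set (MvPolynomial σ K)} (hG : IsGroebnerBasis m I G) :
    idealC y G = (I.map (polyEquiv K y)).leadingCoeff.map
      (rename (Subtype.val : {x : σ // x ≠ y} → σ)) := by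
  have h : (I.map (polyEquiv K y)).leadingCoeff =
      Ideal.span ((fun g => (polyEquiv K y g).leadingCoeff) '' G) := by
    refine le_antisymm (iSup_le fun n => ?_) ?_
    · rw [leadingCoeffNth_eq_span hm hG]
      exact Ideal.span_mono (Set.image_mono fun _ h => h.1)
    · rw [Ideal.span_le]
      rintro _ ⟨g, hg, rfl⟩
      exact (Ideal.mem_leadingCoeff _ _).mpr ⟨_, mem_map_polyEquiv.mpr ⟨g, hG.2.1 hg, rfl⟩, rfl⟩
  rw [h, Ideal.map_span, Set.image_image, idealC]
  simp_rw [← initYCoeff_eq]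

theorem contraction_idealN {m : MonomialOrder.{u, u} σ} {y : σ} (hm : YCompatible K m y)
    {I : Ideal (MvPolynomial σ K)} {G : Set (MvPolynomial σ K)} (hG : IsGroebnerBasis m I G) :
    contraction y (idealN y G) = (I.map (polyEquiv K y)).leadingCoeffNth 0 := by
  rw [idealN_eq hm hG, contraction_map_rename]

theorem contraction_idealC {m : MonomialOrder.{u, u} σ} {y : σ} (hm : YCompatible K m y)
    {I : Ideal (MvPolynomial σ K)} {G : Set (MvPolynomial σ K)} (hG : IsGroebnerBasis m I G) :
    contraction y (idealC y G) = (I.map (polyEquiv K y)).leadingCoeff := by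
  rw [idealC_eq hm hG, contraction_map_rename]

/-- The generators are homogeneous in `y`, so membership is decided one coefficient at a time;
multiplication by powers of `y` is absorbed because `leadingCoeffNth` increases with `n`. -/
theorem mem_map_initYIdeal {y : σ} {I : Ideal (MvPolynomial σ K)}
    {p : Polynomial (MvPolynomial {x : σ // x ≠ y} K)} :
    p ∈ (initYIdeal y I).map (polyEquiv K y) ↔
      ∀ n, p.coeff n ∈ (I.map (polyEquiv K y)).leadingCoeffNth n := by
  constructor
  · intro hp n
    rw [initYIdeal, Ideal.map_span, Set.image_image] at hp
    induction hp using Submodule.span_induction generalizing n with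
    | mem x hx =>
      obtain ⟨f, hf, rfl⟩ := hx
      simp only [polyEquiv_initYForm, Polynomial.coeff_monomial]
      split_ifs with h
      · subst h
        exact (Ideal.mem_leadingCoeffNth _ _ _).mpr
          ⟨_, mem_map_polyEquiv.mpr ⟨f, hf, rfl⟩, Polynomial.degree_le_natDegree, rfl⟩
      · exact zero_mem _
    | zero => simp
    | add x y _ _ hx hy => rw [Polynomial.coeff_add]; exact add_mem (hx n) (hy n)
    | smul a x _ hx =>
      rw [smul_eq_mul, Polynomial.coeff_mul]
      refine Ideal.sum_mem _ fun ij hij => Ideal.mul_mem_left _ _ ?_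
      exact Ideal.leadingCoeffNth_mono _ (by have := Finset.HasAntidiagonal.mem_antidiagonal.mp hij; omega) (hx ij.2)
  · intro h
    rw [p.as_sum_support]
    refine Ideal.sum_mem _ fun n _ => ?_
    obtain ⟨q, hq, hqn, hx⟩ := mem_leadingCoeffNth_iff.mp (h n)
    obtain ⟨f, hf, rfl⟩ := mem_map_polyEquiv.mp hq
    by_cases h0 : (polyEquiv K y f).natDegree = n
    · subst h0
      rw [← hx, Polynomial.coeff_natDegree, ← polyEquiv_initYForm]
      exact Ideal.mem_map_of_mem _ (Ideal.subset_span ⟨f, hf, rfl⟩)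
    · rw [← hx, Polynomial.coeff_eq_zero_of_natDegree_lt (lt_of_le_of_ne hqn h0)]
      simp

theorem mem_map_C_sup_span_X {R : Type*} [CommRing R] {N : Ideal R} {p : Polynomial R} :
    p ∈ N.map Polynomial.C ⊔ Ideal.span {Polynomial.X} ↔ p.coeff 0 ∈ N := by
  constructor
  · intro h
    obtain ⟨a, ha, b, hb, rfl⟩ := Submodule.mem_sup.mp h
    obtain ⟨c, rfl⟩ := Ideal.mem_span_singleton'.mp hb
    simpa using Ideal.mem_map_C_iff.mp ha 0
  · intro h
    rw [← p.divX_mul_X_add, add_comm]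
    exact add_mem (Ideal.mem_sup_left (Ideal.mem_map_of_mem _ h))
      (Ideal.mem_sup_right (Ideal.mul_mem_left _ _ (Ideal.mem_span_singleton_self _)))

/-- The decomposition of the initial ideal holds precisely if the leading coefficients are
generated by those of the elements of degree at most one in `y`. -/
theorem initYIdeal_eq_iff {m : MonomialOrder.{u, u} σ} {y : σ} (hm : YCompatible K m y)
    {I : Ideal (MvPolynomial σ K)} {G : Set (MvPolynomial σ K)} (hG : IsGroebnerBasis m I G) :
    initYIdeal y I = idealC y G ⊓ (idealN y G ⊔ Ideal.span {X y}) ↔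
      (I.map (polyEquiv K y)).leadingCoeff ≤ (I.map (polyEquiv K y)).leadingCoeffNth 1 := by
  set J := I.map (polyEquiv K y) with hJ
  have hmem (f : MvPolynomial σ K) (A : Ideal (MvPolynomial σ K)) :
      f ∈ A ↔ polyEquiv K y f ∈ A.map (polyEquiv K y) := by
    rw [mem_map_polyEquiv]
    exact ⟨fun h => ⟨f, h, rfl⟩, fun ⟨g, hg, h⟩ => (polyEquiv K y).injective h ▸ hg⟩
  have hren (A : Ideal (MvPolynomial {x : σ // x ≠ y} K)) :
      (A.map (rename (Subtype.val : {x : σ // x ≠ y} → σ))).map (polyEquiv K y) =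
        A.map Polynomial.C := map_map_of_eq _ _ _ _ (polyEquiv_rename y)
  have hL (f) : f ∈ initYIdeal y I ↔ ∀ n, (polyEquiv K y f).coeff n ∈ J.leadingCoeffNth n := by
    rw [hmem, mem_map_initYIdeal]
  have hR (f) : f ∈ idealC y G ⊓ (idealN y G ⊔ Ideal.span {X y}) ↔
      (∀ n, (polyEquiv K y f).coeff n ∈ J.leadingCoeff) ∧
        (polyEquiv K y f).coeff 0 ∈ J.leadingCoeffNth 0 := by
    rw [Ideal.mem_inf, hmem, hmem f (_ ⊔ _), Ideal.map_sup, idealC_eq hm hG, idealN_eq hm hG, hren,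
      hren, Ideal.map_span, Set.image_singleton, polyEquiv_X_self, Ideal.mem_map_C_iff,
      mem_map_C_sup_span_X]
  have hle (n) : J.leadingCoeffNth n ≤ J.leadingCoeff := le_iSup (fun n => J.leadingCoeffNth n) n
  constructor
  · intro h a ha
    -- The test element is `a y`: its constant coefficient is zero, so it lies in the right-hand
    -- side, and its coefficient of degree one is `a`.
    have h1 : (polyEquiv K y).symm (Polynomial.C a * Polynomial.X) ∈
        idealC y G ⊓ (idealN y G ⊔ Ideal.span {X y}) := by
      rw [hR, AlgEquiv.apply_symm_apply]
      refine ⟨fun n => ?_, by simp⟩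
      rw [Polynomial.coeff_C_mul_X]
      split_ifs
      exacts [ha, zero_mem _]
    rw [← h, hL, AlgEquiv.apply_symm_apply] at h1
    simpa using h1 1
  · intro h
    ext f
    rw [hL, hR]
    refine ⟨fun hf => ⟨fun n => hle n (hf n), hf 0⟩, fun hf n => ?_⟩
    rcases n.eq_zero_or_pos with rfl | hn
    · exact hf.2
    · exact Ideal.leadingCoeffNth_mono _ hn (h (hf.1 n))

theorem coeff_initYForm (y : σ) (f : MvPolynomial σ K) (e : σ →₀ ℕ) :
    (initYForm y f).coeff e = if e y = f.degreeOf y then f.coeff e else 0 := by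
  classical
  rw [initYForm, coeff_sum]
  simp only [coeff_monomial, Finset.sum_ite_eq', Finset.mem_filter, mem_support_iff]
  by_cases h : f.coeff e = 0 <;> simp [h]

theorem exists_linearOrder_forall_le [Finite σ] (y : σ) :
    ∃ _ : LinearOrder σ, ∀ x, y ≤ x := by
  obtain ⟨n, ⟨e⟩⟩ := Finite.exists_equiv_fin σ
  have : NeZero n := ⟨by rintro rfl; exact (e y).elim0⟩
  let g : σ ≃ Fin n := e.trans (Equiv.swap (e y) 0)
  refine ⟨LinearOrder.lift' g g.injective, fun x => ?_⟩
  change g y ≤ g x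
  have : g y = 0 := by simp [g]
  rw [this]
  exact Fin.zero_le _

theorem exists_yCompatible (K : Type v) [Field K] [Finite σ] (y : σ) :
    ∃ m : MonomialOrder.{u, u} σ, YCompatible K m y := by
  classical
  -- In `MonomialOrder.lex` the least index is the largest variable, so making `y` least means that
  -- `y`-exponents are compared first.
  obtain ⟨i, hmin⟩ := exists_linearOrder_forall_le y
  refine ⟨MonomialOrder.lex, fun f => ?_⟩
  have hlt {d e : σ →₀ ℕ} (h : d y < e y) : MonomialOrder.lex.toSyn d < MonomialOrder.lex.toSyn e :=
    MonomialOrder.lex_lt_iff.mpr ⟨y, fun j hj => absurd hj (not_lt.mpr (hmin j)), h⟩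
  by_cases hf : f = 0
  · simp [hf, initYForm]
  set d := MonomialOrder.lex.degree f with hd
  have hds : d ∈ f.support := MonomialOrder.lex.degree_mem_support hf
  have hdy : d y = f.degreeOf y := by
    refine le_antisymm (monomial_le_degreeOf y hds) ?_
    rw [degreeOf_le_iff]
    intro e he
    by_contra! h
    exact absurd (MonomialOrder.lex.le_degree he) (not_le.mpr (hlt h))
  have hcoeff : (initYForm y f).coeff d = f.coeff d := by rw [coeff_initYForm, if_pos hdy]
  have hdeg : MonomialOrder.lex.degree (initYForm y f) = d := by
    refine MonomialOrder.lex.toSyn.injective (le_antisymm ?_ ?_)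
    · refine MonomialOrder.degree_le_degree_of_support_subset fun e he => ?_
      rw [mem_support_iff, coeff_initYForm] at he
      rw [mem_support_iff]
      exact fun h => he (by simp [h])
    · refine MonomialOrder.lex.le_degree ?_
      rwa [mem_support_iff, hcoeff, ← mem_support_iff]
  rw [MonomialOrder.leadingTerm, MonomialOrder.leadingTerm, MonomialOrder.leadingCoeff,
    MonomialOrder.leadingCoeff, hdeg, hcoeff]

theorem exists_isGroebnerBasis [Finite σ] (m : MonomialOrder.{u, u} σ)
    (I : Ideal (MvPolynomial σ K)) : ∃ G, IsGroebnerBasis m I G := by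
  classical
  obtain ⟨s, hs, h⟩ := (Submodule.fg_span_iff_fg_span_finset_subset _).mp
    (IsNoetherian.noetherian (Ideal.span (m.leadingTerm '' (I : Set (MvPolynomial σ K)))))
  obtain ⟨t, ht, rfl⟩ := Finset.subset_set_image_iff.mp hs
  refine ⟨t, t.finite_toSet, ht, ?_⟩
  rw [Finset.coe_image] at h
  exact h.symm

/-- An ideal is geometrically vertex decomposable if it is unmixed and, with respect to some
variable `y`, its leading coefficients are those of elements of degree at most one, and both the
ideal of leading coefficients and the elimination ideal are geometrically vertex decomposable. -/
theorem IsGVD.of_leadingCoeffNth [Finite σ] {I : Ideal (MvPolynomial σ K)} (hI : IsUnmixed I)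
    (y : σ) (h : (I.map (polyEquiv K y)).leadingCoeff ≤ (I.map (polyEquiv K y)).leadingCoeffNth 1)
    (h₁ : IsGVD ((I.map (polyEquiv K y)).leadingCoeffNth 1))
    (h₀ : IsGVD ((I.map (polyEquiv K y)).leadingCoeffNth 0)) : IsGVD I := by
  obtain ⟨m, hm⟩ := exists_yCompatible K y
  obtain ⟨G, hG⟩ := exists_isGroebnerBasis m I
  refine IsGVD.decomp hI y m hm G hG ((initYIdeal_eq_iff hm hG).mpr h) ?_ ?_
  · rw [contraction_idealC hm hG]
    convert h₁
    exact le_antisymm h (le_iSup (fun n => Ideal.leadingCoeffNth _ n) 1)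
  · rwa [contraction_idealN hm hG]

end Groebner

/-! ### Unmixed ideals and associated primes -/

section Unmixed
variable {R : Type*} [CommRing R]

theorem isUnmixed_iff [IsNoetherianRing R] {I : Ideal R} :
    IsUnmixed I ↔ ∀ P : Ideal R, P.IsPrime → (∃ x, ∀ r, r ∈ P ↔ r * x ∈ I) →
      ringKrullDim (R ⧸ I) = ringKrullDim (R ⧸ P) := by
  have h (P : Ideal R) : P ∈ associatedPrimes R (R ⧸ I) ↔
      P.IsPrime ∧ ∃ x, ∀ r, r ∈ P ↔ r * x ∈ I := by
    rw [AssociatedPrimes.mem_iff, isAssociatedPrime_iff]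
    refine and_congr_right fun _ => ?_
    rw [(Ideal.Quotient.mk_surjective (I := I)).exists]
    refine exists_congr fun x => ?_
    rw [SetLike.ext_iff]
    refine forall_congr' fun r => ?_
    rw [Submodule.mem_colon_singleton, Submodule.mem_bot, Algebra.smul_def,
      Ideal.Quotient.algebraMap_eq, ← map_mul, Ideal.Quotient.eq_zero_iff_mem]
  simp only [IsUnmixed, h, and_imp]

theorem isUnmixed_of_isPrime [IsNoetherianRing R] {I : Ideal R} (hI : I.IsPrime) :
    IsUnmixed I := by
  rw [isUnmixed_iff]
  rintro P hP ⟨x, hx⟩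
  have hxI : x ∉ I := fun h => hP.one_notMem ((hx 1).mpr (by simpa using h))
  rw [show I = P from Ideal.ext fun r => ⟨fun h => (hx r).mpr (I.mul_mem_right _ h),
    fun h => (hI.mem_or_mem ((hx r).mp h)).resolve_right hxI⟩]

theorem isUnmixed_top : IsUnmixed (⊤ : Ideal R) := fun _ hP =>
  have : Subsingleton (R ⧸ (⊤ : Ideal R)) := Ideal.Quotient.subsingleton_iff.mpr rfl
  (not_isAssociatedPrime_of_subsingleton hP).elim

/-- A finite intersection of primes of the same dimension is unmixed. -/
theorem isUnmixed_inf [IsNoetherianRing R] {ι : Type*} (s : Finset ι) (P : ι → Ideal R)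
    (hP : ∀ i ∈ s, (P i).IsPrime)
    (hdim : ∀ i ∈ s, ∀ j ∈ s, ringKrullDim (R ⧸ P i) ≤ ringKrullDim (R ⧸ P j)) :
    IsUnmixed (s.inf P) := by
  classical
  rw [isUnmixed_iff]
  rintro Q hQ ⟨x, hx⟩
  obtain ⟨i, hi, hiQ⟩ : ∃ i ∈ s, Q = P i := by
    -- The intersection of those `P i` that avoid `x` multiplies `x` into the full intersection, so
    -- it lies in the prime `Q`, and hence so does one of them.
    have h1 : ∃ i ∈ {i ∈ s | x ∉ P i}, P i ≤ Q := by
      refine (Ideal.IsPrime.inf_le' hQ).mp fun r hr => (hx r).mpr ?_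
      rw [Submodule.mem_finsetInf] at hr ⊢
      intro i hi
      by_cases hxi : x ∈ P i
      · exact (P i).mul_mem_left _ hxi
      · exact (P i).mul_mem_right _ (hr i (by simp [hi, hxi]))
    obtain ⟨i, hi, hle⟩ := h1
    obtain ⟨hi, hxi⟩ := Finset.mem_filter.mp hi
    refine ⟨i, hi, le_antisymm (fun r hr => ?_) hle⟩
    have := (Submodule.mem_finsetInf.mp ((hx r).mp hr)) i hi
    exact ((hP i hi).mem_or_mem this).resolve_right hxi
  subst hiQ
  refine le_antisymm ?_ ?_
  -- A chain of primes above the intersection starts above some `P j` and so stays above it; the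
  -- dimension of the quotient is thus bounded by that of some `R ⧸ P j`.
  · rw [ringKrullDim_quotient, Order.krullDim]
    refine iSup_le fun p => ?_
    obtain ⟨j, hj, hle⟩ : ∃ j ∈ s, P j ≤ p.head.1.asIdeal :=
      (Ideal.IsPrime.inf_le' p.head.1.isPrime).mp
        ((PrimeSpectrum.mem_zeroLocus _ _).mp p.head.2)
    refine le_trans ?_ (hdim j hj i hi)
    rw [ringKrullDim_quotient]
    have hmem (k) : (p k).1 ∈ PrimeSpectrum.zeroLocus (P j : Set R) :=
      hle.trans (LTSeries.head_le _ k)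
    let q : LTSeries (PrimeSpectrum.zeroLocus (P j : Set R)) :=
      ⟨p.length, fun k => ⟨(p k).1, hmem k⟩, fun k => p.step k⟩
    exact Order.LTSeries.length_le_krullDim q
  · exact ringKrullDim_le_of_surjective (Ideal.Quotient.factor (Finset.inf_le hi))
      (Ideal.Quotient.factor_surjective _)

theorem ringKrullDim_quotient_map {S : Type*} [CommRing S] (e : R ≃+* S) (I : Ideal R) :
    ringKrullDim (S ⧸ I.map e) = ringKrullDim (R ⧸ I) :=
  (ringKrullDim_eq_of_ringEquiv (Ideal.quotientEquiv I _ e rfl)).symm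

theorem IsUnmixed.map_ringEquiv [IsNoetherianRing R] {S : Type*} [CommRing S] (e : R ≃+* S)
    {I : Ideal R} (hI : IsUnmixed I) : IsUnmixed (I.map e) := by
  have : IsNoetherianRing S := isNoetherianRing_of_ringEquiv R e
  rw [isUnmixed_iff] at hI ⊢
  rintro P hP ⟨x, hx⟩
  have hmap : P = (P.comap e).map e := (Ideal.map_comap_of_surjective e e.surjective P).symm
  rw [ringKrullDim_quotient_map, hI (P.comap e) inferInstance, hmap, ringKrullDim_quotient_map,
    ← hmap]
  refine ⟨e.symm x, fun r => ?_⟩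
  rw [Ideal.mem_comap, hx, Ideal.mem_map_of_equiv]
  constructor
  · rintro ⟨a, ha, h⟩
    rw [show r * e.symm x = a from e.injective (by simp [h])]
    exact ha
  · exact fun h => ⟨_, h, by simp⟩

theorem ringKrullDim_quotient_map_C [IsNoetherianRing R] {ρ : Type*} [Finite ρ] (I : Ideal R) :
    ringKrullDim (MvPolynomial ρ R ⧸ I.map (C : R →+* MvPolynomial ρ R)) =
      ringKrullDim (R ⧸ I) + Nat.card ρ := by
  rw [← MvPolynomial.ringKrullDim_of_isNoetherianRing]
  exact (ringKrullDim_eq_of_ringEquiv (quotientEquivQuotientMvPolynomial I).toRingEquiv).symm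

theorem nonempty_monomialOrder (ρ : Type u) [Finite ρ] : Nonempty (MonomialOrder.{u, u} ρ) := by
  obtain ⟨n, ⟨e⟩⟩ := Finite.exists_equiv_fin ρ
  let _ : LinearOrder ρ := LinearOrder.lift' e e.injective
  exact ⟨MonomialOrder.lex⟩

/-- The associated primes of the extension of an ideal to a polynomial ring are extended from
associated primes. -/
theorem exists_eq_map_C_of_mem_iff {ρ : Type*} [Finite ρ] {I : Ideal R}
    {P : Ideal (MvPolynomial ρ R)} (hP : P.IsPrime) {x : MvPolynomial ρ R}
    (hx : ∀ r, r ∈ P ↔ r * x ∈ I.map (C : R →+* MvPolynomial ρ R)) :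
    ∃ p : Ideal R, p.IsPrime ∧ (∃ c, ∀ r, r ∈ p ↔ r * c ∈ I) ∧ P = p.map C := by
  classical
  let φ : MvPolynomial ρ R →+* MvPolynomial ρ (R ⧸ I) := map (Ideal.Quotient.mk I)
  have hφ (r : MvPolynomial ρ R) : φ r = 0 ↔ r ∈ I.map (C : R →+* MvPolynomial ρ R) := by
    rw [mem_map_C_iff, MvPolynomial.ext_iff]
    simp [φ, coeff_map, Ideal.Quotient.eq_zero_iff_mem]
  -- `S` consists of the elements with annihilator `P`. Choose `f` in `S` with fewest terms: if a
  -- scalar `r` outside `P` killed a coefficient of `f`, then `r f` would be in `S` with fewer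
  -- terms. So each nonzero coefficient of `f` has annihilator `P ∩ R`.
  let S : Set (MvPolynomial ρ (R ⧸ I)) := {f | ∀ r, r ∈ P ↔ φ r * f = 0}
  have hS : S.Nonempty := ⟨φ x, fun r => by rw [hx, ← map_mul, hφ]⟩
  obtain ⟨f, hf, hmin⟩ := (measure fun f : MvPolynomial ρ (R ⧸ I) => f.support.card).wf.has_min S hS
  have hf0 : f ≠ 0 := by
    rintro rfl
    exact hP.one_notMem ((hf 1).mpr (mul_zero _))
  have hcoeff {e : ρ →₀ ℕ} (he : e ∈ f.support) (r : R) :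
      C r ∈ P ↔ Ideal.Quotient.mk I r * f.coeff e = 0 := by
    constructor
    · intro hr
      have := congrArg (coeff e) ((hf _).mp hr)
      simpa [φ] using this
    · intro hr
      by_contra hrP
      refine hmin (φ (C r) * f) (fun s => ?_) (Finset.card_lt_card ?_)
      · rw [← mul_assoc, ← map_mul, ← hf]
        exact ⟨fun h => P.mul_mem_right _ h, fun h => (hP.mem_or_mem h).resolve_right hrP⟩
      · refine (Finset.ssubset_iff_of_subset fun d hd => ?_).mpr ⟨e, he, ?_⟩
        · rw [mem_support_iff] at hd ⊢
          intro h
          exact hd (by simp [φ, h])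
        · simpa [φ] using hr
  obtain ⟨m⟩ := nonempty_monomialOrder ρ
  have hlead := m.degree_mem_support hf0
  refine ⟨P.comap C, inferInstance, ?_, le_antisymm ?_ Ideal.map_comap_le⟩
  · obtain ⟨c, hc⟩ := Ideal.Quotient.mk_surjective (f.coeff (m.degree f))
    refine ⟨c, fun r => ?_⟩
    rw [Ideal.mem_comap, hcoeff hlead, ← hc, ← map_mul, Ideal.Quotient.eq_zero_iff_mem]
  -- As `φ g * f = 0`, the leading coefficient of `g` kills that of `f` and so lies in `P ∩ R`. The
  -- leading term of `g` can then be subtracted, and induction on the degree applies.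
  · have key {g : MvPolynomial ρ R} (hg : g ∈ P) : m.leadingCoeff g ∈ P.comap C := by
      rw [Ideal.mem_comap, hcoeff hlead]
      have hdeg : m.toSyn (m.degree (φ g)) ≤ m.toSyn (m.degree g) := by
        rw [m.degree_le_iff]
        intro d hd
        refine m.le_degree ?_
        rw [mem_support_iff] at hd ⊢
        exact fun h => hd (by simp [φ, coeff_map, h])
      have := m.coeff_mul_of_add_of_degree_le hdeg (le_refl (m.toSyn (m.degree f)))
      rw [(hf g).mp hg, coeff_zero, coeff_map] at this
      exact this.symm
    intro g hg
    induction hd : m.toSyn (m.degree g) using WellFoundedLT.induction generalizing g with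
    | ind d ih =>
      have hmem : monomial (m.degree g) (m.leadingCoeff g) ∈ (P.comap C).map C := by
        rw [← mul_one (m.leadingCoeff g), ← C_mul_monomial]
        exact Ideal.mul_mem_right _ _ (Ideal.mem_map_of_mem _ (key hg))
      by_cases h0 : m.degree g = 0
      · rw [m.eq_C_of_degree_eq_zero h0]
        exact Ideal.mem_map_of_mem _ (key hg)
      · have hlt := m.degree_sub_LTerm_lt h0
        rw [hd] at hlt
        have := ih _ hlt (g := m.subLTerm g) (P.sub_mem hg (Ideal.map_comap_le hmem)) rfl
        have h := add_mem this hmem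
        rwa [MonomialOrder.subLTerm, sub_add_cancel] at h

/-- Each associated prime is extended from one of `I`, and extension raises both dimensions by the
number of new variables. -/
theorem IsUnmixed.map_C [IsNoetherianRing R] {ρ : Type*} [Finite ρ] {I : Ideal R}
    (hI : IsUnmixed I) : IsUnmixed (I.map (C : R →+* MvPolynomial ρ R)) := by
  rw [isUnmixed_iff] at hI ⊢
  rintro P hP ⟨x, hx⟩
  obtain ⟨p, hp, hc, rfl⟩ := exists_eq_map_C_of_mem_iff hP hx
  rw [ringKrullDim_quotient_map_C, ringKrullDim_quotient_map_C, hI p hp hc]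

end Unmixed

/-! ### Adding and renaming variables -/

section Extension

theorem map_leadingCoeffNth_le {A B : Type*} [CommRing A] [CommRing B] (j : A →+* B)
    (J : Ideal (Polynomial A)) (n : ℕ) :
    (J.leadingCoeffNth n).map j ≤ (J.map (Polynomial.mapRingHom j)).leadingCoeffNth n := by
  rw [Ideal.map_le_iff_le_comap]
  intro x hx
  obtain ⟨p, hp, hn, rfl⟩ := mem_leadingCoeffNth_iff.mp hx
  exact mem_leadingCoeffNth_iff.mpr ⟨_, Ideal.mem_map_of_mem _ hp,
    (Polynomial.natDegree_map_le).trans hn, by simp⟩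

/-- Taking the coefficients of a fixed monomial in all coefficients of a polynomial. -/
def coeffwise {ρ A : Type*} [CommRing A] (μ : ρ →₀ ℕ) (F : Polynomial (MvPolynomial ρ A)) :
    Polynomial A :=
  ∑ n ∈ F.support, Polynomial.monomial n ((F.coeff n).coeff μ)

theorem coeff_coeffwise {ρ A : Type*} [CommRing A] (μ : ρ →₀ ℕ)
    (F : Polynomial (MvPolynomial ρ A)) (n : ℕ) :
    (coeffwise μ F).coeff n = (F.coeff n).coeff μ := by
  rw [coeffwise, Polynomial.finsetSum_coeff]
  simp only [Polynomial.coeff_monomial, Finset.sum_ite_eq', Polynomial.mem_support_iff]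
  by_cases h : F.coeff n = 0 <;> simp [h]

theorem coeffwise_mem {ρ A : Type*} [CommRing A] (μ : ρ →₀ ℕ) {J : Ideal (Polynomial A)}
    {F : Polynomial (MvPolynomial ρ A)} (hF : F ∈ J.map (Polynomial.mapRingHom C)) :
    coeffwise μ F ∈ J := by
  classical
  induction hF using Submodule.span_induction generalizing μ with
  | mem x hx =>
    obtain ⟨p, hp, rfl⟩ := hx
    have : coeffwise μ (Polynomial.mapRingHom (C : A →+* MvPolynomial ρ A) p) =
        p * Polynomial.C (coeff μ 1) := by
      ext n
      rw [coeff_coeffwise, Polynomial.coe_mapRingHom, Polynomial.coeff_map, Polynomial.coeff_mul_C,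
        ← coeff_C_mul, mul_one]
    rw [this]
    exact J.mul_mem_right _ hp
  | zero =>
    have : coeffwise μ (0 : Polynomial (MvPolynomial ρ A)) = 0 := by simp [coeffwise]
    rw [this]; exact zero_mem _
  | add x y _ _ hx hy =>
    have : coeffwise μ (x + y) = coeffwise μ x + coeffwise μ y := by
      ext n; simp [coeff_coeffwise]
    rw [this]; exact add_mem (hx μ) (hy μ)
  | smul a x _ hx =>
    have : coeffwise μ (a * x) =
        ∑ p ∈ Finset.HasAntidiagonal.antidiagonal μ, coeffwise p.1 a * coeffwise p.2 x := by
      ext n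
      simp only [coeff_coeffwise, Polynomial.coeff_mul, Polynomial.finsetSum_coeff, coeff_sum,
        coeff_mul]
      exact Finset.sum_comm
    rw [smul_eq_mul, this]
    exact sum_mem fun p _ => J.mul_mem_left _ (hx p.2)

/-- An element of the extended ideal has its coefficientwise parts in `J`, and passing to these
parts does not raise the degree. -/
theorem leadingCoeffNth_map_C {ρ A : Type*} [CommRing A] (J : Ideal (Polynomial A)) (n : ℕ) :
    (J.map (Polynomial.mapRingHom (C : A →+* MvPolynomial ρ A))).leadingCoeffNth n =
      (J.leadingCoeffNth n).map C := by
  refine le_antisymm (fun x hx => ?_) (map_leadingCoeffNth_le _ _ _)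
  obtain ⟨F, hF, hn, rfl⟩ := mem_leadingCoeffNth_iff.mp hx
  rw [mem_map_C_iff]
  refine fun μ => mem_leadingCoeffNth_iff.mpr ⟨_, coeffwise_mem μ hF, ?_, coeff_coeffwise μ F n⟩
  rw [Polynomial.natDegree_le_iff_coeff_eq_zero]
  intro N hN
  rw [coeff_coeffwise, Polynomial.coeff_eq_zero_of_natDegree_lt (hn.trans_lt hN), coeff_zero]

variable {K : Type v} [Field K] {σ τ : Type u}

/-- For an injective map `f` of variables, `K[τ]` is a polynomial ring over `K[σ]`. -/
theorem exists_equiv_of_injective (K : Type v) [Field K] [Finite τ] {f : σ → τ}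
    (hf : Function.Injective f) :
    ∃ (ρ : Type u) (_ : Finite ρ)
      (E : MvPolynomial τ K ≃ₐ[K] MvPolynomial ρ (MvPolynomial σ K)),
      ∀ p, E (rename f p) = C p := by
  classical
  let e : τ ≃ ↥(Set.range f)ᶜ ⊕ σ := ((Equiv.sumComm _ _).trans
    (((Equiv.ofInjective f hf).sumCongr (Equiv.refl _)).trans (Equiv.Set.sumCompl (Set.range f)))).symm
  have he (x : σ) : e (f x) = Sum.inr x := by
    rw [Equiv.symm_apply_eq]
    simp
  refine ⟨↥(Set.range f)ᶜ, inferInstance, (renameEquiv K e).trans (sumAlgEquiv K _ _), fun p => ?_⟩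
  induction p using MvPolynomial.induction_on with
  | C a => simp
  | add p q hp hq => simp only [map_add, hp, hq]
  | mul_X p x hp => rw [map_mul, map_mul, hp, rename_X, map_mul]; simp [he]

theorem map_rename_eq {ρ : Type u} {f : σ → τ}
    {E : MvPolynomial τ K ≃ₐ[K] MvPolynomial ρ (MvPolynomial σ K)}
    (hE : ∀ p, E (rename f p) = C p) (I : Ideal (MvPolynomial σ K)) :
    I.map (rename f) = (I.map C).map E.symm.toRingEquiv := by
  refine (map_map_of_eq I C E.symm.toRingEquiv (rename f) fun p => ?_).symm
  rw [← hE]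
  exact E.symm_apply_apply _

theorem leadingCoeffNth_map_rename [Finite τ] {f : σ → τ} (hf : Function.Injective f)
    (J : Ideal (Polynomial (MvPolynomial σ K))) (n : ℕ) :
    (J.map (Polynomial.mapRingHom (rename f : MvPolynomial σ K →ₐ[K] MvPolynomial τ K).toRingHom)).leadingCoeffNth n =
      (J.leadingCoeffNth n).map (rename f) := by
  obtain ⟨ρ, _, E, hE⟩ := exists_equiv_of_injective K hf
  refine le_antisymm (fun x hx => ?_) (map_leadingCoeffNth_le _ _ _)
  have h := map_leadingCoeffNth_le E.toRingEquiv.toRingHom _ n (Ideal.mem_map_of_mem _ hx)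
  have hcomp : (Polynomial.mapRingHom E.toRingEquiv.toRingHom).comp
      (Polynomial.mapRingHom (rename f : MvPolynomial σ K →ₐ[K] _).toRingHom) =
        Polynomial.mapRingHom C := by
    refine RingHom.ext fun p => Polynomial.ext fun k => ?_
    simp only [RingHom.comp_apply, Polynomial.coe_mapRingHom, Polynomial.coeff_map]
    exact hE _
  rw [Ideal.map_map, hcomp, leadingCoeffNth_map_C] at h
  rw [map_rename_eq hE, Ideal.mem_map_of_equiv]
  exact ⟨_, h, E.symm_apply_apply x⟩

theorem IsUnmixed.map_rename [Finite τ] {f : σ → τ} (hf : Function.Injective f)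
    {I : Ideal (MvPolynomial σ K)} (hI : IsUnmixed I) : IsUnmixed (I.map (rename f)) := by
  have : Finite σ := Finite.of_injective f hf
  obtain ⟨ρ, _, E, hE⟩ := exists_equiv_of_injective K hf
  rw [map_rename_eq hE]
  exact hI.map_C.map_ringEquiv _

theorem isPrime_map_rename [Finite τ] {f : σ → τ} (hf : Function.Injective f)
    {I : Ideal (MvPolynomial σ K)} (hI : I.IsPrime) : (I.map (rename f)).IsPrime := by
  obtain ⟨ρ, _, E, hE⟩ := exists_equiv_of_injective K hf
  rw [map_rename_eq hE]
  have : (I.map (C : _ →+* MvPolynomial ρ (MvPolynomial σ K))).IsPrime := by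
    rw [← Ideal.Quotient.isDomain_iff_prime]
    exact (quotientEquivQuotientMvPolynomial (σ := ρ) I).symm.toRingEquiv.toMulEquiv.isDomain _
  exact Ideal.map_isPrime_of_equiv _

/-- The map on the variables other than `y` that is induced by an injective map of variables. -/
def mapNe {f : σ → τ} (hf : Function.Injective f) (y : σ) (x : {x : σ // x ≠ y}) :
    {z : τ // z ≠ f y} :=
  ⟨f x, fun h => x.2 (hf h)⟩

theorem mapNe_injective {f : σ → τ} (hf : Function.Injective f) (y : σ) :
    Function.Injective (mapNe hf y) := fun _ _ h =>
  Subtype.ext (hf (congrArg Subtype.val h))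

theorem polyEquiv_rename_of_injective {f : σ → τ} (hf : Function.Injective f) (y : σ)
    (p : MvPolynomial σ K) :
    polyEquiv K (f y) (rename f p) = Polynomial.mapRingHom
      (rename (mapNe hf y) : MvPolynomial {x : σ // x ≠ y} K →ₐ[K] _).toRingHom
      (polyEquiv K y p) := by
  induction p using MvPolynomial.induction_on with
  | C a =>
    rw [← algebraMap_eq, AlgHom.commutes, AlgEquiv.commutes, AlgEquiv.commutes,
      Polynomial.algebraMap_apply, Polynomial.algebraMap_apply]
    simp
  | add p q hp hq => simp only [map_add, hp, hq]
  | mul_X p x hp =>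
    rw [map_mul, map_mul, hp, map_mul, map_mul, rename_X]
    congr 1
    by_cases h : x = y
    · subst h
      simp
    · have h1 := polyEquiv_X_of_ne (K := K) y ⟨x, h⟩
      have h2 := polyEquiv_X_of_ne (K := K) (f y) (mapNe hf y ⟨x, h⟩)
      simp only at h1
      rw [h1]
      refine h2.trans ?_
      simp

/-- Geometric vertex decomposability is preserved when variables are renamed or added. -/
theorem IsGVD.map_rename {I : Ideal (MvPolynomial σ K)} (hI : IsGVD I) :
    ∀ {τ : Type u} [Finite τ] {f : σ → τ}, Function.Injective f → IsGVD (I.map (rename f)) := by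
  induction hI with
  | top hu h =>
    subst h
    exact fun _ => IsGVD.top (by rw [Ideal.map_top]; exact isUnmixed_top) (Ideal.map_top _)
  | vars hu s h =>
    subst h
    intro τ _ f hf
    refine IsGVD.vars (hu.map_rename hf) (f '' s) ?_
    rw [Ideal.map_span, Set.image_image, Set.image_image]
    simp_rw [rename_X]
  | @decomp σ I hu y m hm G hG h _ _ ihC ihN =>
    intro τ _ f hf
    -- Extension commutes with expansion in the distinguished variable, so both ideals of the
    -- decomposition of the extension are extended from those of `I`, and the induction hypotheses
    -- apply to them.
    have hJ : (I.map (rename f)).map (polyEquiv K (f y)) = (I.map (polyEquiv K y)).map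
        (Polynomial.mapRingHom
          (rename (mapNe hf y) : MvPolynomial {x : σ // x ≠ y} K →ₐ[K] _).toRingHom) :=
      (map_map_of_eq I _ _ ((polyEquiv K (f y)).toRingHom.comp (rename f).toRingHom)
        fun _ => rfl).trans (map_map_of_eq I _ _ _
          fun p => (polyEquiv_rename_of_injective hf y p).symm).symm
    rw [initYIdeal_eq_iff hm hG] at h
    have hle (n) : (I.map (polyEquiv K y)).leadingCoeffNth n ≤
        (I.map (polyEquiv K y)).leadingCoeff := le_iSup (fun n => Ideal.leadingCoeffNth _ n) n
    have h1 := mapNe_injective hf y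
    refine IsGVD.of_leadingCoeffNth (hu.map_rename hf) (f y) ?_ ?_ ?_
    · rw [hJ]
      refine iSup_le fun n => ?_
      rw [leadingCoeffNth_map_rename h1, leadingCoeffNth_map_rename h1]
      exact Ideal.map_mono ((hle n).trans h)
    · rw [hJ, leadingCoeffNth_map_rename h1, ← le_antisymm h (hle 1), ← contraction_idealC hm hG]
      exact ihC h1
    · rw [hJ, leadingCoeffNth_map_rename h1, ← contraction_idealN hm hG]
      exact ihN h1

end Extension

/-! ### Adding a squarefree monomial in new variables to a prime -/

section Monomials

/-- A criterion for geometric vertex decomposability in terms of the leading coefficients of the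
elements of the ideal as polynomials in `y`. -/
theorem IsGVD.of_leadingCoeff_mem {K : Type v} [Field K] {σ : Type u} [Finite σ]
    {I : Ideal (MvPolynomial σ K)} (hI : IsUnmixed I) (y : σ)
    {Q : Ideal (MvPolynomial {x : σ // x ≠ y} K)} {w : MvPolynomial {x : σ // x ≠ y} K}
    (h₀ : ∀ a, Polynomial.C a ∈ I.map (polyEquiv K y) ↔ a ∈ Q)
    (h : ∀ p ∈ I.map (polyEquiv K y), p.leadingCoeff ∈ Q ⊔ Ideal.span {w})
    (h₁ : ∃ p ∈ I.map (polyEquiv K y), p.natDegree ≤ 1 ∧ p.coeff 1 = w)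
    (hQ : IsGVD Q) (hQw : IsGVD (Q ⊔ Ideal.span {w})) : IsGVD I := by
  have e₀ : (I.map (polyEquiv K y)).leadingCoeffNth 0 = Q := by
    ext a
    rw [Ideal.mem_leadingCoeffNth_zero, h₀]
  have hle : (I.map (polyEquiv K y)).leadingCoeff ≤ Q ⊔ Ideal.span {w} := by
    intro a ha
    obtain ⟨p, hp, rfl⟩ := (Ideal.mem_leadingCoeff _ _).mp ha
    exact h p hp
  have hge : Q ⊔ Ideal.span {w} ≤ (I.map (polyEquiv K y)).leadingCoeffNth 1 := by
    refine sup_le ?_ ?_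
    · rw [← e₀]
      exact Ideal.leadingCoeffNth_mono _ zero_le_one
    · rw [Ideal.span_singleton_le_iff_mem]
      exact mem_leadingCoeffNth_iff.mpr h₁
  have e₁ : (I.map (polyEquiv K y)).leadingCoeffNth 1 = Q ⊔ Ideal.span {w} :=
    le_antisymm ((le_iSup (fun n => Ideal.leadingCoeffNth _ n) 1).trans hle) hge
  exact IsGVD.of_leadingCoeffNth hI y (hle.trans hge) (e₁ ▸ hQw) (e₀ ▸ hQ)

/-- If `j + b w` with `j ∈ P` lies in the prime `P + (z)`, then so does `b w`, and since `w` does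
not, `b` does; hence `b w` lies in `P + (z w)`. -/
theorem sup_span_mul_eq_inf {R : Type*} [CommRing R] {P : Ideal R} {z w : R}
    (hP : (P ⊔ Ideal.span {z}).IsPrime) (hw : w ∉ P ⊔ Ideal.span {z}) :
    P ⊔ Ideal.span {z * w} = (P ⊔ Ideal.span {z}) ⊓ (P ⊔ Ideal.span {w}) := by
  refine le_antisymm (le_inf ?_ ?_) ?_
  · exact sup_le_sup_left ((Ideal.span_singleton_le_span_singleton).mpr (dvd_mul_right z w)) _
  · exact sup_le_sup_left ((Ideal.span_singleton_le_span_singleton).mpr (dvd_mul_left w z)) _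
  · rintro x ⟨hx, hx'⟩
    obtain ⟨j, hj, b, hb, rfl⟩ := Submodule.mem_sup.mp hx'
    obtain ⟨b, rfl⟩ := Ideal.mem_span_singleton'.mp hb
    have h1 : b * w ∈ P ⊔ Ideal.span {z} :=
      (Submodule.add_mem_iff_right _ (Ideal.mem_sup_left hj)).mp hx
    obtain ⟨j', hj', c, hc, rfl⟩ := Submodule.mem_sup.mp ((hP.mem_or_mem h1).resolve_right hw)
    obtain ⟨c, rfl⟩ := Ideal.mem_span_singleton'.mp hc
    rw [show j + (j' + c * z) * w = (j + j' * w) + c * (z * w) by ring]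
    exact add_mem (Ideal.mem_sup_left (P.add_mem hj (P.mul_mem_right _ hj')))
      (Ideal.mem_sup_right (Ideal.mul_mem_left _ _ (Ideal.mem_span_singleton_self _)))

variable {K : Type v} [Field K] {σ τ : Type u} {f : σ → τ} {J : Ideal (MvPolynomial σ K)}

theorem X_mem_map_rename_iff (hf : Function.Injective f) {x : σ} :
    X (f x) ∈ J.map (rename f) ↔ X x ∈ J := by
  constructor
  · intro h
    -- Setting all variables outside the range of `f` to `1` is a retraction onto `K[σ]`.
    have := Ideal.mem_map_of_mem (aeval (Function.extend f X 1 : τ → MvPolynomial σ K)) h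
    rw [map_map_of_eq J _ _ (RingHom.id _) fun p => ?_, Ideal.map_id, aeval_X,
      hf.extend_apply] at this
    · exact this
    · rw [aeval_rename, Function.extend_comp hf]
      simp
  · intro h
    rw [← rename_X]
    exact Ideal.mem_map_of_mem _ h

theorem X_notMem_map_rename (hf : Function.Injective f) (hJ : J ≠ ⊤) {t : τ}
    (ht : t ∉ Set.range f) : X t ∉ J.map (rename f) := by
  intro h
  have := Ideal.mem_map_of_mem (aeval (Function.extend f X 1 : τ → MvPolynomial σ K)) h
  rw [map_map_of_eq J _ _ (RingHom.id _) fun p => ?_, Ideal.map_id, aeval_X,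
    Function.extend_apply' _ _ _ ht] at this
  · exact hJ ((Ideal.eq_top_iff_one _).mpr this)
  · rw [aeval_rename, Function.extend_comp hf]
    simp

-- The substitution `X z = 0` fixes polynomials in the old variables and changes any polynomial by a
-- multiple of `X z`. Writing the sum as a preimage yields both its primality and the test for
-- containing another variable.
open Classical in
theorem sup_span_X_eq_comap {z : τ} (hz : z ∉ Set.range f) :
    J.map (rename f) ⊔ Ideal.span {X z} = (J.map (rename f)).comap
      (aeval (Function.update X z 0 : τ → MvPolynomial τ K)) := by
  have hre (p : MvPolynomial σ K) :
      aeval (Function.update X z 0 : τ → MvPolynomial τ K) (rename f p) = rename f p := by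
    have : (aeval (Function.update X z 0 : τ → MvPolynomial τ K)).comp (rename f) =
        (rename f : MvPolynomial σ K →ₐ[K] _) := by
      ext1 x
      rw [AlgHom.comp_apply, rename_X, aeval_X, Function.update_of_ne fun h => hz ⟨x, h⟩]
    exact DFunLike.congr_fun this p
  refine le_antisymm (sup_le ?_ ?_) fun p hp => ?_
  · rw [Ideal.map_le_iff_le_comap]
    intro p hp
    rw [Ideal.mem_comap, Ideal.mem_comap, hre]
    exact Ideal.mem_map_of_mem _ hp
  · rw [Ideal.span_singleton_le_iff_mem, Ideal.mem_comap, aeval_X, Function.update_self]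
    exact zero_mem _
  · have key (p : MvPolynomial τ K) :
        p - aeval (Function.update X z 0 : τ → MvPolynomial τ K) p ∈ Ideal.span {X z} := by
      induction p using MvPolynomial.induction_on with
      | C a => simp
      | add p q hp hq =>
        rw [map_add, add_sub_add_comm]
        exact add_mem hp hq
      | mul_X p x hp =>
        by_cases h : x = z
        · subst h
          simpa using Ideal.mul_mem_left _ p (Ideal.mem_span_singleton_self (X x))
        · rw [map_mul, aeval_X, Function.update_of_ne h, ← sub_mul]
          exact Ideal.mul_mem_right _ _ hp
    rw [← add_sub_cancel (aeval (Function.update X z 0 : τ → MvPolynomial τ K) p) p]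
    exact add_mem (Ideal.mem_sup_left hp) (Ideal.mem_sup_right (key p))

theorem isPrime_sup_span_X [Finite τ] (hf : Function.Injective f) (hJ : J.IsPrime) {z : τ}
    (hz : z ∉ Set.range f) : (J.map (rename f) ⊔ Ideal.span {X z}).IsPrime := by
  have := isPrime_map_rename hf hJ
  rw [sup_span_X_eq_comap hz]
  infer_instance

theorem X_notMem_sup_span_X {z t : τ} (hz : z ∉ Set.range f) (htz : t ≠ z)
    (ht : X t ∉ J.map (rename f)) : X t ∉ J.map (rename f) ⊔ Ideal.span {X z} := by
  classical
  rw [sup_span_X_eq_comap hz, Ideal.mem_comap, aeval_X, Function.update_of_ne htz]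
  exact ht

theorem prod_X_notMem {P : Ideal (MvPolynomial τ K)} (hP : P.IsPrime) {s : Finset τ}
    (h : ∀ t ∈ s, X t ∉ P) : ∏ t ∈ s, X t ∉ P := by
  rw [hP.prod_mem_iff]
  push Not
  exact h

/-- Adding a squarefree monomial in new variables to an extended prime ideal yields the
intersection of the ideals obtained by adding one of these variables. -/
theorem sup_span_prod_eq_inf [Finite τ] (hf : Function.Injective f) (hJ : J.IsPrime)
    {s : Finset τ} (hs : ∀ z ∈ s, z ∉ Set.range f) :
    J.map (rename f) ⊔ Ideal.span {∏ z ∈ s, X z} =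
      s.inf fun z => J.map (rename f) ⊔ Ideal.span {X z} := by
  classical
  induction s using Finset.induction_on with
  | empty => simp
  | insert z s hz ih =>
    rw [Finset.prod_insert hz, Finset.inf_insert, ← ih fun t ht => hs t (Finset.mem_insert_of_mem ht)]
    have hzr := hs z (Finset.mem_insert_self _ _)
    have hp := isPrime_sup_span_X hf hJ hzr
    refine sup_span_mul_eq_inf hp (prod_X_notMem hp fun t ht => ?_)
    exact X_notMem_sup_span_X hzr (fun h => hz (h ▸ ht))
      (X_notMem_map_rename hf hJ.ne_top (hs t (Finset.mem_insert_of_mem ht)))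

/-- Swapping `z` and `z'` is an automorphism that fixes the extension of `J`. -/
theorem ringKrullDim_sup_span_X_le {z z' : τ} (hz : z ∉ Set.range f) (hz' : z' ∉ Set.range f) :
    ringKrullDim (MvPolynomial τ K ⧸ (J.map (rename f) ⊔ Ideal.span {X z})) ≤
      ringKrullDim (MvPolynomial τ K ⧸ (J.map (rename f) ⊔ Ideal.span {X z'})) := by
  classical
  let e : MvPolynomial τ K ≃+* MvPolynomial τ K := (renameEquiv K (Equiv.swap z z')).toRingEquiv
  have h : (J.map (rename f) ⊔ Ideal.span {X z}).map e =
      J.map (rename f) ⊔ Ideal.span {X z'} := by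
    rw [Ideal.map_sup, Ideal.map_span, Set.image_singleton]
    congr 1
    · refine map_map_of_eq J _ _ _ fun p => ?_
      change rename (Equiv.swap z z') (rename f p) = _
      rw [rename_rename]
      congr 2
      ext1 x
      exact Equiv.swap_apply_of_ne_of_ne (fun h => hz ⟨x, h⟩) (fun h => hz' ⟨x, h⟩)
    · change Ideal.span {rename (Equiv.swap z z') (X z)} = _
      rw [rename_X, Equiv.swap_apply_left]
  rw [← h, ringKrullDim_quotient_map]

theorem isUnmixed_sup_span_prod [Finite τ] (hf : Function.Injective f) (hJ : J.IsPrime)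
    {s : Finset τ} (hs : ∀ z ∈ s, z ∉ Set.range f) :
    IsUnmixed (J.map (rename f) ⊔ Ideal.span {∏ z ∈ s, X z}) := by
  rw [sup_span_prod_eq_inf hf hJ hs]
  exact isUnmixed_inf s _ (fun z hz => isPrime_sup_span_X hf hJ (hs z hz))
    fun z hz z' hz' => ringKrullDim_sup_span_X_le (hs z hz) (hs z' hz')

/-- If a prime ideal is geometrically vertex decomposable, then so is the ideal obtained by adding
a squarefree monomial in new variables. -/
theorem IsGVD.sup_span_prod (hJ : J.IsPrime) (h : IsGVD J) [Finite τ]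
    (hf : Function.Injective f) {s : Finset τ} (hs : ∀ z ∈ s, z ∉ Set.range f) :
    IsGVD (J.map (rename f) ⊔ Ideal.span {∏ z ∈ s, X z}) := by
  classical
  -- The ambient variables vary in the induction because the chosen factor `z` is deleted. The empty
  -- product is `1`, so the base case is the unit ideal.
  induction hn : s.card generalizing τ with
  | zero =>
    rw [Finset.card_eq_zero] at hn
    exact IsGVD.top (isUnmixed_sup_span_prod hf hJ hs) (by simp [hn])
  | succ n ih =>
    obtain ⟨z, hz⟩ : s.Nonempty := Finset.card_pos.mp (by omega)
    let f' : σ → {x : τ // x ≠ z} := fun x => ⟨f x, fun h => hs z hz ⟨x, h⟩⟩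
    have hf' : Function.Injective f' := fun a b hab => hf (congrArg Subtype.val hab)
    let s' : Finset {x : τ // x ≠ z} := s.subtype (· ≠ z)
    have hprod : ∏ t ∈ s, X t = X z * rename Subtype.val (∏ t ∈ s', (X t : MvPolynomial _ K)) := by
      rw [map_prod]
      simp_rw [rename_X]
      rw [Finset.prod_subtype_eq_prod_filter (s := s) (p := (· ≠ z)) (f := fun t => X t),
        Finset.filter_ne', Finset.mul_prod_erase s _ hz]
    have hmap : (J.map (rename f) ⊔ Ideal.span {∏ t ∈ s, X t}).map (polyEquiv K z) =
        (J.map (rename f')).map Polynomial.C ⊔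
          Ideal.span {Polynomial.X * Polynomial.C (∏ t ∈ s', X t)} := by
      rw [Ideal.map_sup, Ideal.map_span, Set.image_singleton, hprod, map_mul, polyEquiv_X_self,
        polyEquiv_rename]
      congr 1
      refine (map_map_of_eq J _ _ ((polyEquiv K z).toRingHom.comp (rename f).toRingHom)
        fun _ => rfl).trans (map_map_of_eq J _ _ _ fun p => ?_).symm
      rw [← polyEquiv_rename, rename_rename]
      rfl
    refine IsGVD.of_leadingCoeff_mem (isUnmixed_sup_span_prod hf hJ hs) z
      (Q := J.map (rename f')) (w := ∏ t ∈ s', X t) ?_ ?_ ?_ (h.map_rename hf') (ih hf' ?_ ?_)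
    · intro a
      rw [hmap]
      refine ⟨fun ha => ?_, fun ha => Ideal.mem_sup_left (Ideal.mem_map_of_mem _ ha)⟩
      -- Weakening the generator to `X` suffices to read off the constant coefficient.
      have hle : (J.map (rename f')).map Polynomial.C ⊔
          Ideal.span {Polynomial.X * Polynomial.C (∏ t ∈ s', X t)} ≤
            (J.map (rename f')).map Polynomial.C ⊔ Ideal.span {Polynomial.X} :=
        sup_le_sup_left ((Ideal.span_singleton_le_span_singleton).mpr (dvd_mul_right _ _)) _
      simpa using mem_map_C_sup_span_X.mp (hle ha)
    · intro p hp
      rw [hmap] at hp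
      -- Weakening the generator to the remaining product yields an extended ideal, which contains
      -- every coefficient.
      have hle : (J.map (rename f')).map Polynomial.C ⊔
          Ideal.span {Polynomial.X * Polynomial.C (∏ t ∈ s', X t)} ≤
            (J.map (rename f') ⊔ Ideal.span {∏ t ∈ s', X t}).map Polynomial.C := by
        rw [Ideal.map_sup, Ideal.map_span, Set.image_singleton]
        exact sup_le_sup_left
          ((Ideal.span_singleton_le_span_singleton).mpr (dvd_mul_left _ _)) _
      exact Ideal.mem_map_C_iff.mp (hle hp) _
    · rw [hmap]
      refine ⟨_, Ideal.mem_sup_right (Ideal.mem_span_singleton_self _), ?_,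
        by rw [Polynomial.coeff_X_mul, Polynomial.coeff_C_zero]⟩
      rw [mul_comm]
      exact (Polynomial.natDegree_C_mul_le _ _).trans Polynomial.natDegree_X_le
    · rintro t ht ⟨x, rfl⟩
      exact hs _ (Finset.mem_subtype.mp ht) ⟨x, rfl⟩
    · rw [Finset.card_subtype, Finset.filter_ne', Finset.card_erase_of_mem hz, hn,
        Nat.add_sub_cancel]

end Monomials

/-! ### Leading coefficients of a kernel containing a linear relation -/

section Kernel

/-- The leading coefficients of the kernel of a homomorphism that annihilates `w X - v`. -/
theorem leadingCoeff_mem_of_mem_ker {A S : Type*} [CommRing A] [CommRing S]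
    (ψ : Polynomial A →+* S) {w v : A}
    (hψ : ψ (Polynomial.C w * Polynomial.X) = ψ (Polynomial.C v))
    (hv : ∀ c, c * v ∈ RingHom.ker (ψ.comp Polynomial.C) ⊔ Ideal.span {w} →
      c ∈ RingHom.ker (ψ.comp Polynomial.C) ⊔ Ideal.span {w})
    {p : Polynomial A} (hp : ψ p = 0) :
    p.leadingCoeff ∈ RingHom.ker (ψ.comp Polynomial.C) ⊔ Ideal.span {w} := by
  set Q := RingHom.ker (ψ.comp Polynomial.C) with hQ
  have hpow (k : ℕ) (c : A) : c * v ^ k ∈ Q ⊔ Ideal.span {w} → c ∈ Q ⊔ Ideal.span {w} := by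
    induction k generalizing c with
    | zero => simp
    | succ k ih =>
      intro h
      rw [pow_succ', ← mul_assoc] at h
      exact hv c (ih _ h)
  set d := p.natDegree with hd
  -- This is `p` times `w ^ d` with each `w X` replaced by `v`. All summands but the last are
  -- divisible by `w`, which leaves `p_d v ^ d` modulo `w`.
  have hsum : ∑ i ∈ Finset.range (d + 1), p.coeff i * v ^ i * w ^ (d - i) ∈ Q := by
    rw [hQ, RingHom.mem_ker, RingHom.comp_apply, map_sum, map_sum]
    have h1 : ψ (p * Polynomial.C w ^ d) = 0 := by rw [map_mul, hp, zero_mul]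
    rw [← h1]
    conv_rhs => rw [p.as_sum_range_C_mul_X_pow]
    rw [Finset.sum_mul, map_sum]
    refine Finset.sum_congr rfl fun i hi => ?_
    have hi : i + (d - i) = d := by have := Finset.mem_range.mp hi; omega
    conv_rhs => rw [← hi, pow_add, mul_assoc, ← mul_assoc (Polynomial.X ^ i), ← mul_pow,
      mul_comm Polynomial.X, map_mul, map_mul, map_pow, hψ]
    simp only [map_mul, map_pow, mul_assoc]
  rw [Finset.sum_range_succ, Nat.sub_self, pow_zero, mul_one] at hsum
  refine hpow d _ ?_
  refine (Submodule.add_mem_iff_right _ ?_).mp (Ideal.mem_sup_left hsum)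
  refine Ideal.sum_mem _ fun i hi => Ideal.mul_mem_left _ _ (Ideal.mem_sup_right ?_)
  have : d - i ≠ 0 := by have := Finset.mem_range.mp hi; omega
  exact Ideal.mem_span_singleton.mpr (dvd_pow_self w this)

end Kernel

/-! ### Kernels of monomial maps with independent exponents -/

section Parametrization

/-- In coordinate `t j` the vectors with index above `j` vanish and the multiplicities below `j` are
already known, so the one at `j` is determined. -/
theorem injective_sum_smul_of_triangular {ρ U : Type*} [LinearOrder ρ] [Fintype ρ]
    (ν : ρ → U →₀ ℕ) (t : ρ → U) (hdiag : ∀ k, ν k (t k) ≠ 0) (htri : ∀ j k, j < k → ν k (t j) = 0) :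
    Function.Injective fun μ : ρ →₀ ℕ => ∑ k, μ k • ν k := by
  intro μ μ' h
  ext j
  induction j using WellFoundedLT.induction with
  | ind j ih =>
    have hj := DFunLike.congr_fun h (t j)
    simp only [Finsupp.finsetSum_apply, Finsupp.smul_apply, smul_eq_mul] at hj
    rw [← Finset.add_sum_erase _ _ (Finset.mem_univ j),
      ← Finset.add_sum_erase _ _ (Finset.mem_univ j)] at hj
    rw [Finset.sum_congr rfl (g := fun k => μ' k * ν k (t j))] at hj
    · exact Nat.eq_of_mul_eq_mul_right (Nat.pos_of_ne_zero (hdiag j)) (Nat.add_right_cancel hj)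
    · intro k hk
      rcases lt_or_gt_of_ne (Finset.ne_of_mem_erase hk) with h | h
      · rw [ih k h]
      · rw [htri j k h, mul_zero, mul_zero]

/-- If the variables are sent to terms whose exponent vectors are independent, then the kernel is
extended from the kernel on coefficients. -/
theorem mem_map_C_ker_of_eval₂Hom_eq_zero {A B ρ U : Type*} [CommRing A] [CommRing B] [IsDomain B]
    [Fintype ρ] (α : A →+* B) (ν : ρ → U →₀ ℕ) (b : ρ → B) (hb : ∀ k, b k ≠ 0)
    (hν : Function.Injective fun μ : ρ →₀ ℕ => ∑ k, μ k • ν k) {p : MvPolynomial ρ A}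
    (hp : eval₂Hom (C.comp α) (fun k => monomial (ν k) (b k)) p = 0) :
    p ∈ (RingHom.ker α).map C := by
  classical
  rw [mem_map_C_iff]
  intro μ
  rw [RingHom.mem_ker]
  have hterm (μ' : ρ →₀ ℕ) : eval₂Hom (C.comp α) (fun k => monomial (ν k) (b k))
      (monomial μ' (p.coeff μ')) =
        monomial (∑ k, μ' k • ν k) (α (p.coeff μ') * ∏ k, b k ^ μ' k) := by
    rw [eval₂Hom_monomial, Finsupp.prod_fintype _ _ (by simp)]
    simp_rw [monomial_pow]
    rw [← monomial_sum_prod, RingHom.comp_apply, C_mul_monomial]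
  -- By independence only the term of `μ` contributes to this exponent, so nothing cancels.
  have h := congrArg (coeff (∑ k, μ k • ν k)) hp
  rw [p.as_sum, map_sum, coeff_sum, coeff_zero, Finset.sum_eq_single μ] at h
  · rw [hterm, coeff_monomial, if_pos rfl] at h
    exact (mul_eq_zero.mp h).resolve_right
      (Finset.prod_ne_zero_iff.mpr fun k _ => pow_ne_zero _ (hb k))
  · intro μ' _ hne
    rw [hterm, coeff_monomial, if_neg fun h => hne (hν h)]
  · intro hμ
    rw [notMem_support_iff.mp hμ]
    simp

variable {K : Type v} [Field K]

/-- The exponents of the new variables in a variable. -/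
def newExponent {V U : Type*} : V ⊕ U → U →₀ ℕ :=
  Sum.elim (fun _ => 0) fun q => Finsupp.single q 1

/-- The coefficient, in the old variables, of a variable. -/
def oldCoeff (K : Type v) [Field K] {V U : Type*} : V ⊕ U → MvPolynomial V K :=
  Sum.elim X fun _ => 1

/-- Polynomials in the old and the new variables as polynomials in the new variables. -/
def splitVars (K : Type v) [Field K] (V U : Type*) :
    MvPolynomial (V ⊕ U) K →ₐ[K] MvPolynomial U (MvPolynomial V K) :=
  aeval fun w => monomial (newExponent w) (oldCoeff K w)

theorem splitVars_rename_inl {V U : Type*} (p : MvPolynomial V K) :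
    splitVars K V U (rename Sum.inl p) = C p := by
  induction p using MvPolynomial.induction_on with
  | C a => rw [rename_C, ← algebraMap_eq, AlgHom.commutes]; rfl
  | add p q hp hq => simp only [map_add, hp, hq]
  | mul_X p x hp =>
    rw [map_mul, map_mul, hp, map_mul, rename_X, splitVars, aeval_X]
    rfl

theorem newExponent_apply {V U : Type*} [DecidableEq V] [DecidableEq U] (w : V ⊕ U) (q : U) :
    newExponent w q = if w = Sum.inr q then 1 else 0 := by
  cases w with
  | inl a => simp [newExponent]
  | inr r => simp [newExponent, Finsupp.single_apply]

theorem oldCoeff_ne_zero {V U : Type*} (w : V ⊕ U) : oldCoeff K w ≠ 0 := by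
  cases w with
  | inl a => exact X_ne_zero a
  | inr r => exact one_ne_zero

/-- The kernel of a homomorphism that sends new variables to monomials whose exponents in new
variables are independent. -/
theorem ker_eq_map_rename {σ τ V U ρ : Type*} [Fintype ρ] (α : MvPolynomial σ K →ₐ[K] MvPolynomial V K)
    (θ : MvPolynomial τ K →ₐ[K] MvPolynomial (V ⊕ U) K) (f : σ → τ) (g : ρ → τ)
    (hfg : ∀ t, t ∈ Set.range f ∨ t ∈ Set.range g)
    (hf : ∀ x, θ (X (f x)) = rename Sum.inl (α (X x))) (w w' : ρ → V ⊕ U)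
    (hg : ∀ k, θ (X (g k)) = X (w k) * X (w' k))
    (hν : Function.Injective
      fun μ : ρ →₀ ℕ => ∑ k, μ k • (newExponent (w k) + newExponent (w' k))) :
    RingHom.ker θ = (RingHom.ker α).map (rename f) := by
  have hθf (p : MvPolynomial σ K) : θ (rename f p) = rename Sum.inl (α p) := by
    have : θ.comp (rename f) = (rename Sum.inl).comp α := by
      ext1 x
      simp [hf]
    exact DFunLike.congr_fun this p
  refine le_antisymm (fun p hp => ?_) ?_
  -- Every element of `K[τ]` is written as a polynomial in the new variables over the old ones;
  -- uniqueness of this expression is not required.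
  · let π : MvPolynomial ρ (MvPolynomial σ K) →+* MvPolynomial τ K :=
      eval₂Hom (rename f).toRingHom fun k => X (g k)
    have hπ : Function.Surjective π := by
      intro p
      induction p using MvPolynomial.induction_on with
      | C a => exact ⟨C (C a), by simp [π]⟩
      | add p q hp hq =>
        obtain ⟨p, rfl⟩ := hp
        obtain ⟨q, rfl⟩ := hq
        exact ⟨p + q, map_add _ _ _⟩
      | mul_X p t hp =>
        obtain ⟨p, rfl⟩ := hp
        rcases hfg t with ⟨x, rfl⟩ | ⟨k, rfl⟩
        · exact ⟨p * C (X x), by simp [π]⟩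
        · exact ⟨p * X k, by simp [π]⟩
    obtain ⟨q, rfl⟩ := hπ p
    have hcomp : ((splitVars K V U).toRingHom.comp θ.toRingHom).comp π =
        eval₂Hom (C.comp α.toRingHom) fun k =>
          monomial (newExponent (w k) + newExponent (w' k)) (oldCoeff K (w k) * oldCoeff K (w' k)) := by
      refine MvPolynomial.ringHom_ext (fun a => ?_) fun k => ?_
      · simp [π, hθf, splitVars_rename_inl]
      · simp [π, hg, splitVars, monomial_mul]
    have h0 := DFunLike.congr_fun hcomp q
    rw [RingHom.comp_apply, RingHom.comp_apply, show θ.toRingHom (π q) = 0 from hp, map_zero] at h0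
    have hq := Ideal.mem_map_of_mem π (mem_map_C_ker_of_eval₂Hom_eq_zero _ _ _
      (fun k => mul_ne_zero (oldCoeff_ne_zero (w k)) (oldCoeff_ne_zero (w' k))) hν h0.symm)
    rwa [map_map_of_eq _ _ _ (rename f : MvPolynomial σ K →ₐ[K] MvPolynomial τ K)] at hq
    intro x
    simp [π]
  · rw [Ideal.map_le_iff_le_comap]
    intro p hp
    rw [Ideal.mem_comap, RingHom.mem_ker, hθf, RingHom.mem_ker.mp hp, map_zero]

end Parametrization

/-! ### Attaching a path of odd length -/

section Path

/-- The two alternating sets of edges of an even cycle are perfect matchings, so both sides are the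
product of all vertices. -/
theorem prod_path_eq {R : Type*} [CommRing R] (x : ℕ → R) (N : ℕ) :
    (∏ i ∈ Finset.range N, x (2 * i + 2) * x (2 * i + 3)) * (x 0 * x 1) =
      (x 0 * x (2 * N + 1)) * ∏ i ∈ Finset.range N, x (2 * i + 1) * x (2 * i + 2) := by
  induction N with
  | zero => simp
  | succ N ih =>
    rw [Finset.prod_range_succ, Finset.prod_range_succ, show 2 * (N + 1) + 1 = 2 * N + 3 by ring]
    linear_combination x (2 * N + 2) * x (2 * N + 3) * ih

variable {K : Type v} [Field K]

@[simp]
theorem edgeMonomial_mk {V : Type*} (a b : V) : edgeMonomial K s(a, b) = X a * X b := rfl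

theorem edgeMonomial_map_inl {V U : Type*} (e : Sym2 V) :
    edgeMonomial K (e.map (Sum.inl : V → V ⊕ U)) = rename Sum.inl (edgeMonomial K e) := by
  induction e with
  | h a b => simp

end Path

section Path
variable {K : Type v} [Field K]

instance isPrime_toricIdeal {V : Type u} (G : SimpleGraph V) : (toricIdeal K G).IsPrime :=
  RingHom.ker_isPrime _

theorem X_notMem_toricIdeal {V : Type u} (G : SimpleGraph V) (e : G.edgeSet) :
    X e ∉ toricIdeal K G := by
  obtain ⟨e, he⟩ := e
  induction e with
  | h a b =>
    rw [toricIdeal, RingHom.mem_ker, aeval_X]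
    exact mul_ne_zero (X_ne_zero a) (X_ne_zero b)

/-- Adding to a graph a path of odd length between two adjacent vertices preserves geometric vertex
decomposability of the toric ideal. -/
theorem isGVD_toricIdeal_of_path {V : Type u} {U : Type} [Finite V] [Finite U] {G : SimpleGraph V}
    {H : SimpleGraph (V ⊕ U)} (hG : IsGVD (toricIdeal K G)) {a b : V} (hab : G.Adj a b)
    {N : ℕ} (hN : 0 < N) (u : ℕ → V ⊕ U) (hu : Set.InjOn u (Set.Iic (2 * N + 1)))
    (ha : u 0 = Sum.inl a) (hb : u (2 * N + 1) = Sum.inl b) (t : Fin (2 * N) → U)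
    (ht : ∀ k : Fin (2 * N), u (k + 1) = Sum.inr (t k))
    (hH : ∀ e, e ∈ H.edgeSet ↔
      e ∈ Sym2.map Sum.inl '' G.edgeSet ∨ ∃ k ≤ 2 * N, e = s(u k, u (k + 1))) :
    IsGVD (toricIdeal K H) := by
  classical
  have huinj {i j : ℕ} (hi : i ≤ 2 * N + 1) (hj : j ≤ 2 * N + 1) (h : u i = u j) : i = j :=
    hu hi hj h
  let f : G.edgeSet → H.edgeSet := fun e => ⟨e.1.map Sum.inl, (hH _).mpr (Or.inl ⟨e, e.2, rfl⟩)⟩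
  have hf : Function.Injective f := fun e e' h =>
    Subtype.ext (Sym2.map.injective Sum.inl_injective (congrArg Subtype.val h))
  let y : H.edgeSet := ⟨s(u 0, u 1), (hH _).mpr (Or.inr ⟨0, Nat.zero_le _, rfl⟩)⟩
  let g : Fin (2 * N) → H.edgeSet := fun k =>
    ⟨s(u (k + 1), u (k + 2)), (hH _).mpr (Or.inr ⟨k + 1, k.2, rfl⟩)⟩
  have hinr {k : ℕ} (hk : k < 2 * N) (e : G.edgeSet) : u (k + 1) ∉ (f e).1 := by
    rw [ht ⟨k, hk⟩, Sym2.mem_map]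
    rintro ⟨x, -, h⟩
    cases h
  have hfy (e) : f e ≠ y := by
    intro h
    refine hinr (k := 0) (by omega) e ?_
    rw [h]
    exact Sym2.mem_mk_right _ _
  have hgf (k) : g k ∉ Set.range f := by
    rintro ⟨e, h⟩
    refine hinr k.2 e ?_
    rw [h]
    exact Sym2.mem_mk_left _ _
  have hgy (k) : g k ≠ y := by
    intro h
    rcases Sym2.eq_iff.mp (congrArg Subtype.val h) with ⟨h1, h2⟩ | ⟨h1, h2⟩
    · have := huinj (by omega) (by omega) h1
      omega
    · have := huinj (by omega) (by omega) h2
      omega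
  have hginj : Function.Injective g := by
    intro k k' h
    rcases Sym2.eq_iff.mp (congrArg Subtype.val h) with ⟨h1, h2⟩ | ⟨h1, h2⟩
    · have := huinj (by omega) (by omega) h1
      omega
    · have := huinj (by omega) (by omega) h1
      have := huinj (by omega) (by omega) h2
      omega
  let f' : G.edgeSet → {x : H.edgeSet // x ≠ y} := fun e => ⟨f e, hfy e⟩
  have hf' : Function.Injective f' := fun e e' h => hf (congrArg Subtype.val h)
  let g' : Fin (2 * N) → {x : H.edgeSet // x ≠ y} := fun k => ⟨g k, hgy k⟩
  have hg' : Function.Injective g' := fun e e' h => hginj (congrArg Subtype.val h)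
  have hgf' (k) : g' k ∉ Set.range f' := by
    rintro ⟨e, h⟩
    exact hgf k ⟨e, congrArg Subtype.val h⟩
  have hcover (x : {x : H.edgeSet // x ≠ y}) : x ∈ Set.range f' ∨ x ∈ Set.range g' := by
    obtain ⟨⟨e, he⟩, hx⟩ := x
    rcases (hH e).mp he with ⟨e₀, he₀, rfl⟩ | ⟨k, hk, rfl⟩
    · exact Or.inl ⟨⟨e₀, he₀⟩, rfl⟩
    · rcases k with _ | k
      · exact absurd rfl hx
      · exact Or.inr ⟨⟨k, hk⟩, rfl⟩
  -- the homomorphism defining the toric ideal, restricted to the edges other than `y`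
  let Ψ : MvPolynomial H.edgeSet K →ₐ[K] MvPolynomial (V ⊕ U) K :=
    aeval fun e : H.edgeSet => edgeMonomial K (e : Sym2 (V ⊕ U))
  let θ : MvPolynomial {x : H.edgeSet // x ≠ y} K →ₐ[K] MvPolynomial (V ⊕ U) K :=
    Ψ.comp (rename Subtype.val)
  have hθX (x) : θ (X x) = edgeMonomial K (x.1 : Sym2 (V ⊕ U)) := by
    simp [θ, Ψ]
  set J := toricIdeal K G with hJ
  have hker : RingHom.ker θ = J.map (rename f') := by
    refine ker_eq_map_rename _ θ f' g' hcover (fun e => ?_) (fun k : Fin (2 * N) => u (k + 1))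
      (fun k => u (k + 2)) (fun k => ?_) ?_
    · rw [hθX, aeval_X]
      exact edgeMonomial_map_inl _
    · rw [hθX]
      rfl
    -- Apart from the interior vertex `u (k + 1)`, the edge `g' k` contains only the later vertex `u
    -- (k + 2)`, so the exponents are triangular. The last edge ends at the old vertex `b`.
    · refine injective_sum_smul_of_triangular _ t (fun k => ?_) (fun j k hjk => ?_)
      · simp only [Finsupp.add_apply, newExponent_apply]
        rw [if_pos (ht k)]
        omega
      · simp only [Finsupp.add_apply, newExponent_apply, ← ht]
        have hjk : (j : ℕ) < k := hjk
        rw [if_neg, if_neg]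
        · intro h
          have := huinj (by omega) (by omega) h
          omega
        · intro h
          have := huinj (by omega) (by omega) h
          omega
  -- the two monomials of the binomial of the cycle
  let o : Fin N → {x : H.edgeSet // x ≠ y} := fun i => g' ⟨2 * i + 1, by omega⟩
  let v₀ : Fin N → {x : H.edgeSet // x ≠ y} := fun i => g' ⟨2 * i, by omega⟩
  let s : Finset {x : H.edgeSet // x ≠ y} := Finset.univ.image o
  have hs : ∀ z ∈ s, z ∉ Set.range f' := by
    intro z hz
    obtain ⟨i, -, rfl⟩ := Finset.mem_image.mp hz
    exact hgf' _
  let w : MvPolynomial {x : H.edgeSet // x ≠ y} K := ∏ z ∈ s, X z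
  let e₀ : G.edgeSet := ⟨s(a, b), hab⟩
  let q : MvPolynomial {x : H.edgeSet // x ≠ y} K := X (f' e₀) * ∏ i, X (v₀ i)
  have hθw : θ w * (X (u 0) * X (u 1)) = θ q := by
    have hw : θ w = ∏ i ∈ Finset.range N, X (u (2 * i + 2)) * X (u (2 * i + 3)) := by
      have ho : Function.Injective o := by
        intro i j h
        have := congrArg Fin.val (hg' h)
        exact Fin.ext (by simp only at this; omega)
      rw [map_prod, Finset.prod_image fun _ _ _ _ h => ho h, Finset.prod_range]
      exact Finset.prod_congr rfl fun i _ => hθX _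
    have hq : θ q = (X (u 0) * X (u (2 * N + 1))) *
        ∏ i ∈ Finset.range N, X (u (2 * i + 1)) * X (u (2 * i + 2)) := by
      rw [map_mul, hθX, map_prod, Finset.prod_range, ha, hb]
      exact congrArg _ (Finset.prod_congr rfl fun i _ => hθX _)
    rw [hw, hq]
    exact prod_path_eq (fun i => X (u i)) N
  let ψ : Polynomial (MvPolynomial {x : H.edgeSet // x ≠ y} K) →+* MvPolynomial (V ⊕ U) K :=
    Ψ.toRingHom.comp (polyEquiv K y).symm.toRingEquiv.toRingHom
  have hψ (p) : ψ p = Ψ ((polyEquiv K y).symm p) := rfl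
  have hψC (p) : ψ (Polynomial.C p) = θ p := by
    rw [hψ, polyEquiv_symm_C]
    rfl
  have hψX : ψ Polynomial.X = X (u 0) * X (u 1) := by
    rw [hψ, ← polyEquiv_X_self (K := K) y, AlgEquiv.symm_apply_apply]
    exact aeval_X _ _
  have hmem (p) : p ∈ (toricIdeal K H).map (polyEquiv K y) ↔ ψ p = 0 := by
    rw [mem_map_polyEquiv]
    constructor
    · rintro ⟨p, hp, rfl⟩
      rw [hψ, AlgEquiv.symm_apply_apply]
      exact hp
    · exact fun h => ⟨_, h, AlgEquiv.apply_symm_apply _ _⟩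
  have hkerC : RingHom.ker (ψ.comp Polynomial.C) = J.map (rename f') := by
    rw [← hker]
    ext p
    rw [RingHom.mem_ker, RingHom.mem_ker, RingHom.comp_apply, hψC]
  have hJp : J.IsPrime := isPrime_toricIdeal G
  have hrel : ψ (Polynomial.C w * Polynomial.X) = ψ (Polynomial.C q) := by
    rw [map_mul, hψC, hψC, hψX, hθw]
  refine IsGVD.of_leadingCoeff_mem (isUnmixed_of_isPrime (isPrime_toricIdeal H)) y
    (Q := J.map (rename f')) (w := w) (fun p => ?_) (fun p hp => ?_)
    ⟨Polynomial.C w * Polynomial.X - Polynomial.C q, ?_, ?_, by simp⟩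
    (hG.map_rename hf') (hG.sup_span_prod hJp hf' hs)
  · rw [hmem, hψC, ← hker, RingHom.mem_ker]
  · have := leadingCoeff_mem_of_mem_ker ψ hrel (fun c hc => ?_) ((hmem p).mp hp)
    · rwa [hkerC] at this
    -- Cancelling `q` may be checked in each prime `Q + (z)` with `z` a factor of `w`. None contains
    -- a factor of `q`: the edge of `G` is no element of the toric ideal, and the other factors are
    -- path edges different from `z`.
    · rw [hkerC, sup_span_prod_eq_inf hf' hJp hs, Submodule.mem_finsetInf] at hc ⊢
      intro z hz
      have hP := isPrime_sup_span_X hf' hJp (hs z hz)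
      refine (hP.mem_or_mem (hc z hz)).resolve_right fun hq => ?_
      rcases hP.mem_or_mem hq with h | h
      · refine X_notMem_sup_span_X (hs z hz) (fun h => hs z hz ⟨e₀, h⟩) ?_ h
        rw [X_mem_map_rename_iff hf']
        exact X_notMem_toricIdeal G e₀
      · obtain ⟨i, -, hi⟩ := hP.prod_mem_iff.mp h
        refine X_notMem_sup_span_X (hs z hz) (fun h => ?_)
          (X_notMem_map_rename hf' hJp.ne_top (hgf' _)) hi
        obtain ⟨j, -, rfl⟩ := Finset.mem_image.mp hz
        have := congrArg Fin.val (hg' h)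
        simp only at this
        omega
  · rw [hmem, map_sub, hrel, sub_self]
  · exact (Polynomial.natDegree_sub_C).trans_le
      ((Polynomial.natDegree_C_mul_le _ _).trans Polynomial.natDegree_X_le)

end Path

/-! ### Enumerating a cycle from an edge -/

section Cycle

theorem val_nsmul_one {m : ℕ} (k : ℕ) : ((k • (1 : Fin (m + 2)) : Fin (m + 2)) : ℕ) = k % (m + 2) := by
  induction k with
  | zero => simp
  | succ k ih => rw [succ_nsmul, Fin.val_add, ih, Fin.val_one, Nat.mod_add_mod]

/-- The vertices of a cycle can be enumerated from one of two adjacent vertices to the other. -/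
theorem exists_cycleGraph_enumeration {M m : ℕ} (hM : M = m + 2) {c d : Fin M}
    (h : (SimpleGraph.cycleGraph M).Adj c d) :
    ∃ p : ℕ → Fin M, p 0 = c ∧ p (m + 1) = d ∧ Set.InjOn p (Set.Iic (m + 1)) ∧
      (∀ k, (SimpleGraph.cycleGraph M).Adj (p k) (p (k + 1))) ∧
      ∀ x y, (SimpleGraph.cycleGraph M).Adj x y →
        s(x, y) = s(c, d) ∨ ∃ k ≤ m, s(x, y) = s(p k, p (k + 1)) := by
  subst hM
  -- The step `ε` leads from `c` away from `d`. As `(m + 2) • ε = 0`, walking `m + 1` steps from `c`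
  -- ends at `c - ε = d`.
  obtain ⟨ε, hε, hcd⟩ : ∃ ε : Fin (m + 2), (ε = 1 ∨ ε = -1) ∧ c - d = ε := by
    rcases SimpleGraph.cycleGraph_adj.mp h with h | h
    · exact ⟨1, Or.inl rfl, h⟩
    · exact ⟨-1, Or.inr rfl, by rw [← h, neg_sub]⟩
  have hadj (x y : Fin (m + 2)) :
      (SimpleGraph.cycleGraph (m + 2)).Adj x y ↔ y = x + ε ∨ x = y + ε := by
    rw [SimpleGraph.cycleGraph_adj, sub_eq_iff_eq_add', sub_eq_iff_eq_add']
    rcases hε with rfl | rfl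
    · exact or_comm
    · rw [← sub_eq_add_neg, ← sub_eq_add_neg, eq_sub_iff_add_eq, eq_sub_iff_add_eq, eq_comm,
        eq_comm (a := y)]
  have hone (z : Fin (m + 2)) : (z : ℕ) • (1 : Fin (m + 2)) = z :=
    Fin.ext (by rw [val_nsmul_one, Nat.mod_eq_of_lt z.2])
  have hinj {k j : ℕ} (hk : k ≤ m + 1) (hj : j ≤ m + 1) (h : k • ε = j • ε) : k = j := by
    have h1 : k • (1 : Fin (m + 2)) = j • 1 := by
      rcases hε with rfl | rfl
      · exact h
      · rwa [smul_neg, smul_neg, neg_inj] at h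
    have h2 := congrArg Fin.val h1
    rwa [val_nsmul_one, val_nsmul_one, Nat.mod_eq_of_lt (by omega),
      Nat.mod_eq_of_lt (by omega)] at h2
  have hlast : (m + 1) • ε + ε = 0 := by
    rw [← succ_nsmul]
    have h1 : (m + 1 + 1) • (1 : Fin (m + 2)) = 0 := Fin.ext (by rw [val_nsmul_one]; simp)
    rcases hε with rfl | rfl
    · exact h1
    · rw [smul_neg, h1, neg_zero]
  have hd : c + (m + 1) • ε = d := by
    rw [eq_neg_of_add_eq_zero_left hlast, ← hcd]
    abel
  have hsurj (x : Fin (m + 2)) : ∃ k ≤ m + 1, x = c + k • ε := by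
    rcases hε with rfl | rfl
    · exact ⟨(x - c : Fin (m + 2)), by omega, by rw [hone]; abel⟩
    · exact ⟨(c - x : Fin (m + 2)), by omega, by rw [smul_neg, hone]; abel⟩
  have key (x : Fin (m + 2)) : s(x, x + ε) = s(c, d) ∨
      ∃ k ≤ m, s(x, x + ε) = s(c + k • ε, c + (k + 1) • ε) := by
    obtain ⟨k, hk, rfl⟩ := hsurj x
    rcases Nat.lt_or_ge m k with hmk | hmk
    · left
      obtain rfl : k = m + 1 := by omega
      rw [add_assoc, hlast, add_zero, hd, Sym2.eq_swap]
    · exact Or.inr ⟨k, hmk, by rw [succ_nsmul, add_assoc]⟩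
  refine ⟨fun k => c + k • ε, by simp, hd, fun k hk j hj h => hinj hk hj (add_left_cancel h),
    fun k => (hadj _ _).mpr (Or.inl (by simp only [succ_nsmul, add_assoc])), fun x y hxy => ?_⟩
  rcases (hadj _ _).mp hxy with rfl | rfl
  · exact key x
  · rw [Sym2.eq_swap]
    exact key y

end Cycle

end GVD

end

/-- If the toric ideal of a finite simple graph `G` is geometrically vertex decomposable, then so
is the toric ideal of the graph obtained by gluing an edge `{c, d}` of a cycle of even length
`2 * n` onto an edge `{a, b}` of `G`. -/
theorem mainTheorem2 {K : Type v} [Field K] [IsAlgClosed K] [CharZero K]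
    {V : Type u} [Finite V] (G : SimpleGraph V)
    (hG : GVD.IsGVD (GVD.toricIdeal K G))
    (n : ℕ) (hn : 2 ≤ n)
    (a b : V) (_hab : G.Adj a b)
    (c d : Fin (2 * n)) (_hcd : (SimpleGraph.cycleGraph (2 * n)).Adj c d)
    (φ : G.induce {a, b} ≃g (SimpleGraph.cycleGraph (2 * n)).induce {c, d}) :
    GVD.IsGVD (GVD.toricIdeal K (GVD.glue φ)) := by
  classical
  obtain ⟨N, rfl⟩ : ∃ N, n = N + 1 := ⟨n - 1, by omega⟩
  have ha : a ∈ ({a, b} : Set V) := Or.inl rfl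
  have hb : b ∈ ({a, b} : Set V) := Or.inr rfl
  have hadj : (SimpleGraph.cycleGraph (2 * (N + 1))).Adj (φ ⟨a, ha⟩) (φ ⟨b, hb⟩) :=
    φ.map_adj_iff.mpr _hab
  -- Enumerating from the image of `a` to that of `b`, rather than from `c` to `d`, covers both ways
  -- of identifying the edges.
  obtain ⟨p, hp0, hp1, hinj, hpadj, hedge⟩ := GVD.exists_cycleGraph_enumeration (M := 2 * (N + 1)) (m := 2 * N) rfl hadj
  have hga : GVD.glueRight φ (φ ⟨a, ha⟩) = Sum.inl a :=
    ((GVD.inl_eq_glueRight_iff φ a _).mpr ⟨ha, rfl⟩).symm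
  have hgb : GVD.glueRight φ (φ ⟨b, hb⟩) = Sum.inl b :=
    ((GVD.inl_eq_glueRight_iff φ b _).mpr ⟨hb, rfl⟩).symm
  -- An identified vertex is the image of `a` or `b`, that is, an end of the enumeration; by
  -- injectivity the interior vertices are new.
  have hmem (k : Fin (2 * N)) : p (k + 1) ∉ ({c, d} : Set (Fin (2 * (N + 1)))) := by
    intro h
    have hx := (φ.symm ⟨_, h⟩).2
    have hφ : φ (φ.symm ⟨_, h⟩) = ⟨p (k + 1), h⟩ := φ.apply_symm_apply _
    rcases hx with hx | hx
    · rw [show φ.symm ⟨_, h⟩ = ⟨a, ha⟩ from Subtype.ext hx] at hφ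
      have := hinj (Set.mem_Iic.mpr (by omega)) (Set.mem_Iic.mpr (by omega))
        (hp0.trans (congrArg Subtype.val hφ))
      omega
    · rw [show φ.symm ⟨_, h⟩ = ⟨b, hb⟩ from Subtype.ext hx] at hφ
      have := hinj (Set.mem_Iic.mpr (by omega)) (Set.mem_Iic.mpr (by omega))
        (hp1.trans (congrArg Subtype.val hφ))
      omega
  refine GVD.isGVD_toricIdeal_of_path hG _hab (N := N) (by omega) (fun k => GVD.glueRight φ (p k))
    (fun i hi j hj h => hinj hi hj (GVD.glueRight_injective φ h)) (by rw [hp0, hga])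
    (by rw [hp1, hgb]) (fun k => ⟨p (k + 1), hmem k⟩)
    (fun k => by rw [GVD.glueRight, dif_neg (hmem k)]) fun e => ?_
  rw [GVD.glue, SimpleGraph.edgeSet_sup, Set.mem_union]
  rw [show (G.map Sum.inl).edgeSet = Sym2.map Sum.inl '' G.edgeSet from
    SimpleGraph.edgeSet_map ⟨Sum.inl, Sum.inl_injective⟩ G,
    show ((SimpleGraph.cycleGraph (2 * (N + 1))).map (GVD.glueRight φ)).edgeSet =
      Sym2.map (GVD.glueRight φ) '' (SimpleGraph.cycleGraph (2 * (N + 1))).edgeSet from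
    SimpleGraph.edgeSet_map ⟨_, GVD.glueRight_injective φ⟩ _]
  constructor
  · rintro (h | ⟨e, he, rfl⟩)
    · exact Or.inl h
    · induction e with
      | h x y =>
        rcases hedge x y he with h | ⟨k, hk, h⟩
        -- The closing edge of the cycle is the one identified with the edge `{a, b}` of `G`.
        · left
          rw [h, Sym2.map_mk, hga, hgb]
          exact ⟨s(a, b), _hab, rfl⟩
        · right
          exact ⟨k, hk, by rw [h, Sym2.map_mk]⟩
  · rintro (h | ⟨k, hk, rfl⟩)
    · exact Or.inl h
    · exact Or.inr ⟨s(p k, p (k + 1)), hpadj k, rfl⟩
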